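/- Let $n\ge 2$ and $w_0\ge 1$. A \emph{rooted tree} is here a tree $T_0$ on $n$ vertices with a distinguished vertex $v_0$ (the root, its only boundary vertex), in which one edge at $v_0$ has weight $w_0$ and all other edges have weight $1$ (the choice of this edge is part of the data; for $w_0=1$ the tree is unweighted). The degree $d(v)$ of a vertex is its number of neighbours, a vertex of degree $1$ is called pendant, and the degree sequence of $T_0$ is the multiset of the degrees of all its vertices, including the root. The first Dirichlet eigenvalue $\nu(T_0)$ is the smallest eigenvalue of the matrix obtained from the weighted graph Laplacian $D-A$ of $T_0$ by deleting the row and the column of $v_0$. A \emph{caterpillar} is a tree in which removing all pendant vertices leaves a (possibly empty) path. Lemma. Let $\pi$ be a degree sequence and let $T_0$ be a rooted tree with degree sequence $\pi$. (1) $T_0$ has minimal first Dirichlet eigenvalue among all rooted trees with degree sequence $\pi$ if and only if $T_0$ is a caterpillar, its root $v_0$ is pendant, and $v_0$ together with the non-pendant vertices of $T_0$ forms a path $(v_0,v_1,\dots,v_k)$ starting at the root along which the degrees are non-decreasing: $d(v_0)\le d(v_1)\le\dots\le d(v_k)$. (2) $T_0$ has minimal first Dirichlet eigenvalue among all rooted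 trees with degree sequence $\pi$ whose root has the same degree $d(v_0)$ as the root of $T_0$ if and only if $T_0$ is a caterpillar, $v_0$ together with the non-pendant vertices of $T_0$ forms a path $(v_0,v_1,\dots,v_k)$ starting at the root with $d(v_1)\le\dots\le d(v_k)$, and, in case $w_0>1$ and $d(v_0)\ge 2$, the edge of weight $w_0$ joins $v_0$ to a pendant vertex. -/

import Mathlib

/-- A tree on the vertex set `V` with a root (its only boundary vertex) and one distinguished
boundary edge, joining `root` to `mark`. The distinguished edge is the one that may carry a weight
different from `1`. Since there is a boundary edge, there is at least one interior vertex. -/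
structure DirichletTree (V : Type*) where
  graph : SimpleGraph V
  isTree : graph.IsTree
  root : V
  mark : V
  adj_mark : graph.Adj root mark

namespace DirichletTree

variable {V : Type*} [Fintype V]

open Classical in
/-- The degree of a vertex: the number of its neighbours (weights play no role). -/
noncomputable def degree (T : DirichletTree V) (v : V) : ℕ := T.graph.degree v

/-- The degree sequence: the multiset of the degrees of all vertices, the root included. -/
noncomputable def degreeSequence (T : DirichletTree V) : Multiset ℕ :=
  (Finset.univ : Finset V).val.map T.degree

open Classical in
/-- Edge weights: `w₀` on the distinguished boundary edge, `1` on all other edges, `0` on pairs that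
are not edges. -/
noncomputable def weight (w₀ : ℝ) (T : DirichletTree V) (u v : V) : ℝ :=
  if T.graph.Adj u v then (if s(u, v) = s(T.root, T.mark) then w₀ else 1) else 0

open Classical in
/-- The weighted graph Laplacian `D - A`. -/
noncomputable def laplacian (w₀ : ℝ) (T : DirichletTree V) : Matrix V V ℝ :=
  Matrix.diagonal (fun v => ∑ u, T.weight w₀ v u) - Matrix.of (T.weight w₀)

/-- The Dirichlet matrix: the Laplacian with the row and the column of the root deleted. -/
noncomputable def dirichletMatrix (w₀ : ℝ) (T : DirichletTree V) :
    Matrix {v : V // v ≠ T.root} {v : V // v ≠ T.root} ℝ :=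
  (T.laplacian w₀).submatrix Subtype.val Subtype.val

open Classical in
/-- The first Dirichlet eigenvalue: the smallest eigenvalue of the Dirichlet matrix. -/
noncomputable def firstDirichletEigenvalue (w₀ : ℝ) (T : DirichletTree V) : ℝ :=
  sInf {μ : ℝ | Module.End.HasEigenvalue (Matrix.toLin' (T.dirichletMatrix w₀)) μ}

open Classical in
/-- The infimum in the definition of the first Dirichlet eigenvalue is attained. -/
theorem firstDirichletEigenvalue_isLeast (w₀ : ℝ) (T : DirichletTree V) :
    IsLeast {μ : ℝ | Module.End.HasEigenvalue (Matrix.toLin' (T.dirichletMatrix w₀)) μ}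
      (T.firstDirichletEigenvalue w₀) := by
  have hsymm : (T.dirichletMatrix w₀).IsHermitian := by
    have hl : (T.laplacian w₀).IsHermitian := by
      unfold laplacian
      refine (Matrix.isHermitian_diagonal _).sub ?_
      ext u v
      simp [weight, T.graph.adj_comm u v, Sym2.eq_swap (a := u) (b := v)]
    exact hl.submatrix _
  have hset : {μ : ℝ | Module.End.HasEigenvalue (Matrix.toLin' (T.dirichletMatrix w₀)) μ}
      = Set.range hsymm.eigenvalues := by
    rw [← hsymm.spectrum_real_eq_range_eigenvalues, ← Matrix.spectrum_toLin']
    ext μ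
    exact Module.End.hasEigenvalue_iff_mem_spectrum
  have : Nonempty {v : V // v ≠ T.root} := ⟨⟨T.mark, T.adj_mark.ne'⟩⟩
  unfold firstDirichletEigenvalue
  rw [hset]
  exact ⟨(Set.range_nonempty _).csInf_mem (Set.finite_range _),
    fun _ h => csInf_le (Set.finite_range _).bddBelow h⟩

/-- A caterpillar: removing all pendant vertices (vertices of degree 1) gives a path
(an empty one in the case of a single edge). -/
def IsCaterpillar (T : DirichletTree V) : Prop :=
  ∃ k : ℕ, Nonempty (T.graph.induce {v | T.degree v ≠ 1} ≃g SimpleGraph.pathGraph k)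

/-- `p` is a path starting at the root whose vertices are exactly the root and all the non-pendant
vertices of the tree. -/
def IsSpine (T : DirichletTree V) {v : V} (p : T.graph.Walk T.root v) : Prop :=
  p.IsPath ∧ ∀ u : V, u ∈ p.support ↔ u = T.root ∨ T.degree u ≠ 1

end DirichletTree

/-!
Write `par v` for the parent of `v`, `wt v` for the weight of the edge between them, and
`g v = f v - f (par v)` for the increment of a function `f` that vanishes at the root. The first
Dirichlet eigenvalue `ν` is the minimum of the Rayleigh quotient `∑ wt v * (g v)² / ∑ (f v)²`, and
it is attained by a nonnegative function whose increments are nonnegative, and positive where the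
function is (`IsPerron.par_le`, `IsPerron.par_lt`).

If `ν < 1`, the eigenfunction satisfies `f q = κ * f (par q)` at the pendant vertices `q`, where
`κ = (1 - ν)⁻¹`. Eliminating these values leaves a quadratic form in the values at the inner
vertices, i.e. the non-pendant vertices other than the root (`energy_sub_eq`):
`∑ wt v * (g v)² - ν * (∑ (f v)² + κ * (∑ (deg v - 2) * (f v)² + ∑ ((f v)² - (f (par v))²)))`.

Now list the inner vertices `w 0, …, w (k - 1)` of an arbitrary tree with parents first, and lay the
increments of its eigenfunction one after the other along the spine of a caterpillar: its `j`-th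
vertex gets the value `F j = ∑ i < j, g (w i)`. The first sum does not increase (the edge of weight
`w₀` is at the top of both trees, or carries no increment on the spine). The partial sums dominate
the values `f (w j)`, which include only the increments along one path, and the partial sums
increase, so by the rearrangement inequality the sum with the degrees is largest if these are
non-decreasing along the spine; the last sum telescopes and increases as well
(`reduced_form_comparison`). Hence the caterpillar has the smaller eigenvalue
(`IsSortedSpine.firstDirichletEigenvalue_le`). If the eigenvalues agree, the test function is an
eigenfunction of the caterpillar, so `F` is strictly increasing; all estimates being sharp,
`par (w j)` must be `w (j - 1)` and the degrees along `w` must be non-decreasing, so the other tree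
is a sorted caterpillar as well.

A non-pendant root may be put in front of the list with increment `0`. This compares all trees with
a caterpillar whose root is pendant, and there equality is impossible. Caterpillars with the
required degrees exist (`exists_isSortedSpine`), so the minimizers are exactly the sorted
caterpillars. Stars centred at their root have no inner vertices and are treated directly.
-/

/-! ### Parents in a rooted tree -/

namespace DirichletTree

section Parent

variable {V : Type*} (T : DirichletTree V)

open Classical in
/-- The parent of a vertex: the last vertex before `v` on the path from the root to `v`. The root is
its own parent, so that differences `f v - f (T.par v)` vanish at the root. -/
noncomputable def par (v : V) : V := (T.isTree.existsUnique_path T.root v).exists.choose.penultimate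

theorem par_root : T.par T.root = T.root := by
  have h := (T.isTree.existsUnique_path T.root T.root).unique
    (T.isTree.existsUnique_path T.root T.root).exists.choose_spec SimpleGraph.Walk.IsPath.nil
  exact congrArg SimpleGraph.Walk.penultimate h

/-- The depth of a vertex: its distance from the root. -/
noncomputable def depth (v : V) : ℕ := T.graph.dist T.root v

theorem par_eq_of_adj_of_depth {u v : V} (h : T.graph.Adj u v) (hd : T.depth v = T.depth u + 1) :
    T.par v = u := by
  obtain ⟨p, hp, hl⟩ := T.isTree.connected.exists_path_of_dist T.root u
  have hv : v ∉ p.support := by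
    intro hv
    classical
    have h1 := SimpleGraph.dist_le (p.takeUntil v hv)
    have h2 := p.length_takeUntil_le_length hv
    unfold depth at hd
    omega
  have hq : (p.concat h).IsPath := hp.concat hv h
  have h' := (T.isTree.existsUnique_path T.root v).unique
    (T.isTree.existsUnique_path T.root v).exists.choose_spec hq
  exact (congrArg SimpleGraph.Walk.penultimate h').trans (by simp)

theorem exists_adj_depth {v : V} (hv : v ≠ T.root) :
    ∃ u, T.graph.Adj u v ∧ T.depth v = T.depth u + 1 := by
  obtain ⟨p, hp, hl⟩ := T.isTree.connected.exists_path_of_dist T.root v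
  have hnil : ¬ p.Nil := fun h => hv h.eq.symm
  have hadj : T.graph.Adj p.penultimate v := p.adj_penultimate hnil
  refine ⟨p.penultimate, hadj, ?_⟩
  have h1 : T.graph.dist T.root p.penultimate ≤ p.dropLast.length := SimpleGraph.dist_le _
  have h2 : p.dropLast.length = p.length - 1 := by simp
  have h3 := T.isTree.dist_eq_dist_add_one_of_adj T.root hadj
  unfold depth
  omega

theorem adj_par {v : V} (hv : v ≠ T.root) : T.graph.Adj (T.par v) v := by
  obtain ⟨u, h, hd⟩ := T.exists_adj_depth hv
  rwa [T.par_eq_of_adj_of_depth h hd]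

theorem depth_par {v : V} (hv : v ≠ T.root) : T.depth v = T.depth (T.par v) + 1 := by
  obtain ⟨u, h, hd⟩ := T.exists_adj_depth hv
  rwa [T.par_eq_of_adj_of_depth h hd]

theorem par_ne {v : V} (hv : v ≠ T.root) : T.par v ≠ v := (T.adj_par hv).ne

theorem adj_iff_par {u v : V} :
    T.graph.Adj u v ↔ (u ≠ T.root ∧ T.par u = v) ∨ (v ≠ T.root ∧ T.par v = u) := by
  constructor
  · intro h
    have h0 : T.depth T.root = 0 := SimpleGraph.dist_self
    rcases T.isTree.dist_eq_dist_add_one_of_adj T.root h with h1 | h1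
    · refine Or.inl ⟨?_, T.par_eq_of_adj_of_depth h.symm h1⟩
      rintro rfl
      unfold depth at h0
      omega
    · refine Or.inr ⟨?_, T.par_eq_of_adj_of_depth h h1⟩
      rintro rfl
      unfold depth at h0
      omega
  · rintro (⟨h, rfl⟩ | ⟨h, rfl⟩)
    · exact (T.adj_par h).symm
    · exact T.adj_par h

theorem not_par_par {u v : V} (hu : u ≠ T.root) (h : T.par u = v) (hv : v ≠ T.root) :
    T.par v ≠ u := by
  rintro rfl
  have h1 := T.depth_par hu
  have h2 := T.depth_par hv
  rw [h] at h1
  omega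

theorem mark_ne_root : T.mark ≠ T.root := T.adj_mark.ne'

theorem par_mark : T.par T.mark = T.root := by
  rcases T.adj_iff_par.1 T.adj_mark with h | h
  · exact absurd rfl h.1
  · exact h.2

end Parent

section Children

variable {V : Type*} [Fintype V] (T : DirichletTree V)

open Classical in
/-- The children of a vertex: its neighbours away from the root. -/
noncomputable def children (v : V) : Finset V := {c | c ≠ T.root ∧ T.par c = v}

theorem mem_children {v c : V} : c ∈ T.children v ↔ c ≠ T.root ∧ T.par c = v := by
  simp [children]

open Classical in
theorem degree_eq_card_children (v : V) :
    T.degree v = (T.children v).card + if v = T.root then 0 else 1 := by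
  unfold degree
  rw [← SimpleGraph.card_neighborFinset_eq_degree]
  by_cases hv : v = T.root
  · have : T.graph.neighborFinset v = T.children v := by
      ext u
      rw [SimpleGraph.mem_neighborFinset, adj_iff_par, mem_children]
      simp [hv]
    simp [this, hv]
  · have hn : T.par v ∉ T.children v := fun h =>
      T.not_par_par hv rfl ((T.mem_children.1 h).1) (T.mem_children.1 h).2
    have : T.graph.neighborFinset v = insert (T.par v) (T.children v) := by
      ext u
      rw [SimpleGraph.mem_neighborFinset, adj_iff_par, Finset.mem_insert, mem_children]
      simp [hv, eq_comm]
    rw [this, Finset.card_insert_of_notMem hn]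
    simp [hv]

theorem degree_pos (v : V) : 0 < T.degree v := by
  rw [degree_eq_card_children]
  split_ifs with h
  · have : T.mark ∈ T.children v := T.mem_children.2 ⟨T.mark_ne_root, h ▸ T.par_mark⟩
    have := Finset.card_pos.2 ⟨_, this⟩
    omega
  · omega

theorem children_eq_empty {v : V} (hv : v ≠ T.root) (h1 : T.degree v = 1) : T.children v = ∅ := by
  rw [degree_eq_card_children, if_neg hv] at h1
  exact Finset.card_eq_zero.1 (by omega)

theorem degree_par_ne_one {v : V} (hv : v ≠ T.root) (hp : T.par v ≠ T.root) :
    T.degree (T.par v) ≠ 1 := by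
  intro h
  have := T.children_eq_empty hp h
  have hm : v ∈ T.children (T.par v) := T.mem_children.2 ⟨hv, rfl⟩
  simp [this] at hm

theorem children_nonempty {v : V} (hv : v ≠ T.root) (h : T.degree v ≠ 1) :
    (T.children v).Nonempty := by
  rw [Finset.nonempty_iff_ne_empty]
  intro h0
  rw [degree_eq_card_children, if_neg hv, h0] at h
  simp at h

open Classical in
theorem sum_par {M : Type*} [AddCommMonoid M] (φ : V → V → M) :
    ∑ v, ∑ c ∈ T.children v, φ v c = ∑ c with c ≠ T.root, φ (T.par c) c := by
  simp only [children]
  simp_rw [Finset.sum_filter]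
  rw [Finset.sum_comm]
  refine Finset.sum_congr rfl fun c _ => ?_
  by_cases hc : c = T.root <;> simp [hc]

end Children

end DirichletTree

/-! ### Dirichlet energy and the first eigenvalue -/

namespace DirichletTree

section Weight

variable {V : Type*} (w₀ : ℝ) (T : DirichletTree V)

/-- The weight of the edge from a vertex to its parent; it is `0` for the root. -/
noncomputable def wt (v : V) : ℝ := T.weight w₀ v (T.par v)

theorem weight_comm (u v : V) : T.weight w₀ u v = T.weight w₀ v u := by
  by_cases h : T.graph.Adj u v
  · rw [weight, weight, if_pos h, if_pos h.symm, Sym2.eq_swap]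
  · have h' : ¬ T.graph.Adj v u := fun h' => h h'.symm
    simp [weight, h, h']

theorem wt_root : T.wt w₀ T.root = 0 := by
  simp [wt, weight, par_root]

theorem wt_mark : T.wt w₀ T.mark = w₀ := by
  have := T.adj_mark.symm
  simp [wt, weight, par_mark, this, Sym2.eq_swap (a := T.mark)]

theorem wt_of_ne {v : V} (hv : v ≠ T.root) (hm : v ≠ T.mark) : T.wt w₀ v = 1 := by
  have := (T.adj_par hv).symm
  simp [wt, weight, this, hv, hm]

theorem wt_of_par_ne {v : V} (hv : v ≠ T.root) (hp : T.par v ≠ T.root) : T.wt w₀ v = 1 := by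
  refine T.wt_of_ne w₀ hv ?_
  rintro rfl
  exact hp T.par_mark

variable {w₀}

theorem one_le_wt (hw : 1 ≤ w₀) {v : V} (hv : v ≠ T.root) : 1 ≤ T.wt w₀ v := by
  by_cases hm : v = T.mark
  · subst hm; rwa [wt_mark]
  · rw [T.wt_of_ne w₀ hv hm]

theorem wt_le (hw : 1 ≤ w₀) (v : V) : T.wt w₀ v ≤ w₀ := by
  by_cases hv : v = T.root
  · rw [hv, wt_root]; linarith
  by_cases hm : v = T.mark
  · rw [hm, wt_mark]
  · rwa [T.wt_of_ne w₀ hv hm]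

theorem wt_nonneg (hw : 1 ≤ w₀) (v : V) : 0 ≤ T.wt w₀ v := by
  by_cases hv : v = T.root
  · subst hv; rw [wt_root]
  · linarith [T.one_le_wt hw hv]

variable (w₀)

open Classical in
theorem weight_eq (u v : V) : T.weight w₀ u v =
    (if u ≠ T.root ∧ T.par u = v then T.wt w₀ u else 0) +
      (if v ≠ T.root ∧ T.par v = u then T.wt w₀ v else 0) := by
  by_cases h1 : u ≠ T.root ∧ T.par u = v
  · have h2 : ¬ (v ≠ T.root ∧ T.par v = u) := fun h => T.not_par_par h1.1 h1.2 h.1 h.2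
    rw [if_pos h1, if_neg h2, wt, h1.2, add_zero]
  · by_cases h2 : v ≠ T.root ∧ T.par v = u
    · rw [if_neg h1, if_pos h2, wt, h2.2, zero_add, weight_comm]
    · have : ¬ T.graph.Adj u v := by rw [adj_iff_par]; tauto
      rw [if_neg h1, if_neg h2, weight, if_neg this, add_zero]

end Weight

variable {V : Type*} [Fintype V] (w₀ : ℝ) (T : DirichletTree V)

/-- The weighted graph Laplacian applied to a function. -/
noncomputable def lap (f : V → ℝ) (v : V) : ℝ := ∑ u, T.weight w₀ v u * (f v - f u)

/-- The Dirichlet energy, summed over the edges, each of them seen from its lower endpoint. -/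
noncomputable def energy (f : V → ℝ) : ℝ := ∑ v, T.wt w₀ v * (f v - f (T.par v)) ^ 2

/-- The Laplacian at a vertex: the flux to the parent minus the fluxes from the children. -/
theorem lap_eq (f : V → ℝ) (v : V) : T.lap w₀ f v = T.wt w₀ v * (f v - f (T.par v)) -
    ∑ c ∈ T.children v, T.wt w₀ c * (f c - f v) := by
  classical
  unfold lap
  simp_rw [weight_eq, add_mul, Finset.sum_add_distrib, ite_mul, zero_mul]
  rw [sub_eq_add_neg, ← Finset.sum_neg_distrib]
  congr 1
  · by_cases hv : v = T.root
    · subst hv; simp [wt_root]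
    · simp [hv]
  · rw [children, Finset.sum_filter]
    refine Finset.sum_congr rfl fun c _ => ?_
    split_ifs <;> ring

/-- Green's formula. -/
theorem sum_mul_lap (f h : V → ℝ) : ∑ v, h v * T.lap w₀ f v =
    ∑ v, T.wt w₀ v * ((f v - f (T.par v)) * (h v - h (T.par v))) := by
  classical
  have h0 : ∀ v, h v * T.lap w₀ f v = h v * (T.wt w₀ v * (f v - f (T.par v))) -
      ∑ c ∈ T.children v, h v * (T.wt w₀ c * (f c - f v)) := fun v => by
    rw [lap_eq, mul_sub, Finset.mul_sum]
  have h1 := T.sum_par (fun v c => h v * (T.wt w₀ c * (f c - f v)))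
  have h2 : ∑ c with c ≠ T.root, h (T.par c) * (T.wt w₀ c * (f c - f (T.par c))) =
      ∑ c, h (T.par c) * (T.wt w₀ c * (f c - f (T.par c))) := by
    refine Finset.sum_filter_of_ne fun c _ hc h0 => hc ?_
    rw [h0, wt_root]; ring
  simp only [h0]
  rw [Finset.sum_sub_distrib, h1, h2, ← Finset.sum_sub_distrib]
  refine Finset.sum_congr rfl fun c _ => ?_
  ring

theorem sum_mul_lap_self (f : V → ℝ) : ∑ v, f v * T.lap w₀ f v = T.energy w₀ f := by
  rw [sum_mul_lap]
  refine Finset.sum_congr rfl fun c _ => ?_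
  ring

open Classical in
theorem sum_nonroot_eq (φ : V → ℝ) (h : φ T.root = 0) :
    ∑ u : {v : V // v ≠ T.root}, φ u = ∑ u, φ u := by
  rw [← Finset.sum_subtype (Finset.univ.filter (· ≠ T.root)) (by simp) φ]
  refine Finset.sum_filter_of_ne fun c _ hc h0 => hc ?_
  rw [h0, h]

open Classical in
theorem dirichletMatrix_mulVec (f : V → ℝ) (hf : f T.root = 0) (v : {v : V // v ≠ T.root}) :
    (T.dirichletMatrix w₀).mulVec (fun u => f u) v = T.lap w₀ f v := by
  simp only [Matrix.mulVec, dotProduct, dirichletMatrix, laplacian, Matrix.submatrix_apply,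
    Matrix.sub_apply, Matrix.of_apply, sub_mul, Finset.sum_sub_distrib]
  rw [T.sum_nonroot_eq (fun u => T.weight w₀ v u * f u) (by simp [hf]),
    T.sum_nonroot_eq (fun u => Matrix.diagonal (fun v => ∑ u, T.weight w₀ v u) v.1 u * f u)
      (by simp [hf])]
  simp [lap, mul_sub, Matrix.diagonal_apply, Finset.sum_mul]

theorem dirichletMatrix_isHermitian : (T.dirichletMatrix w₀).IsHermitian := by
  classical
  have hl : (T.laplacian w₀).IsHermitian := by
    unfold laplacian
    refine (Matrix.isHermitian_diagonal _).sub ?_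
    ext u v
    simp [T.weight_comm w₀ u v]
  exact hl.submatrix _

theorem posSemidef_sub_firstDirichletEigenvalue :
    letI := Classical.decEq V
    (T.dirichletMatrix w₀ - T.firstDirichletEigenvalue w₀ • 1).PosSemidef := by
  classical
  have hH : (T.dirichletMatrix w₀ - T.firstDirichletEigenvalue w₀ • 1).IsHermitian :=
    (T.dirichletMatrix_isHermitian w₀).sub (by simp [Matrix.IsHermitian])
  refine hH.posSemidef_iff_eigenvalues_nonneg.2 fun i => ?_
  have hi := hH.mulVec_eigenvectorBasis i
  have h0 : (hH.eigenvectorBasis i).ofLp ≠ 0 := fun h0 =>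
    (hH.eigenvectorBasis.toBasis.ne_zero i) (by
      rw [OrthonormalBasis.coe_toBasis]; exact (WithLp.ofLp_eq_zero _).1 h0)
  have : Module.End.HasEigenvalue (Matrix.toLin' (T.dirichletMatrix w₀))
      (hH.eigenvalues i + T.firstDirichletEigenvalue w₀) := by
    refine Module.End.hasEigenvalue_of_hasEigenvector (x := (hH.eigenvectorBasis i).ofLp)
      ⟨Module.End.mem_eigenspace_iff.2 ?_, h0⟩
    rw [Matrix.sub_mulVec, Matrix.smul_mulVec, Matrix.one_mulVec] at hi
    rw [Matrix.toLin'_apply, add_smul, ← hi]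
    abel
  have := (T.firstDirichletEigenvalue_isLeast w₀).2 this
  simpa using this

theorem star_dotProduct_sub_mulVec (f : V → ℝ) (hf : f T.root = 0) (ν : ℝ) :
    letI := Classical.decEq V
    star (fun u : {v : V // v ≠ T.root} => f u) ⬝ᵥ
      ((T.dirichletMatrix w₀ - ν • 1).mulVec (fun u => f u)) =
    T.energy w₀ f - ν * ∑ v, f v ^ 2 := by
  classical
  rw [Matrix.sub_mulVec, Matrix.smul_mulVec, Matrix.one_mulVec, dotProduct]
  simp only [Pi.sub_apply, Pi.smul_apply, Pi.star_apply, star_trivial, smul_eq_mul,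
    T.dirichletMatrix_mulVec w₀ f hf]
  rw [T.sum_nonroot_eq (fun u => f u * (T.lap w₀ f u - ν * f u)) (by simp [hf])]
  simp_rw [mul_sub]
  rw [Finset.sum_sub_distrib, sum_mul_lap_self, Finset.mul_sum]
  congr 1
  exact Finset.sum_congr rfl fun v _ => by ring

/-- The Rayleigh principle. -/
theorem firstDirichletEigenvalue_mul_le (f : V → ℝ) (hf : f T.root = 0) :
    T.firstDirichletEigenvalue w₀ * ∑ v, f v ^ 2 ≤ T.energy w₀ f := by
  classical
  have h := (T.posSemidef_sub_firstDirichletEigenvalue w₀).dotProduct_mulVec_nonneg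
    (fun u => f u)
  rw [T.star_dotProduct_sub_mulVec w₀ f hf] at h
  linarith

/-- A minimizer of the Rayleigh quotient is an eigenfunction. -/
theorem lap_eq_of_energy_eq (f : V → ℝ) (hf : f T.root = 0)
    (h : T.energy w₀ f = T.firstDirichletEigenvalue w₀ * ∑ v, f v ^ 2) {v : V}
    (hv : v ≠ T.root) : T.lap w₀ f v = T.firstDirichletEigenvalue w₀ * f v := by
  classical
  have h1 := T.star_dotProduct_sub_mulVec w₀ f hf (T.firstDirichletEigenvalue w₀)
  rw [h, sub_self,
    (T.posSemidef_sub_firstDirichletEigenvalue w₀).dotProduct_mulVec_zero_iff] at h1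
  have h2 := congrFun h1 ⟨v, hv⟩
  rw [Matrix.sub_mulVec, Matrix.smul_mulVec, Matrix.one_mulVec, Pi.sub_apply,
    T.dirichletMatrix_mulVec w₀ f hf] at h2
  simp only [Pi.smul_apply, smul_eq_mul, Pi.zero_apply] at h2
  linarith

/-- `f` is a nonnegative eigenfunction for the first Dirichlet eigenvalue. -/
structure IsPerron (f : V → ℝ) : Prop where
  root : f T.root = 0
  nonneg : ∀ v, 0 ≤ f v
  ne_zero : ∃ v, f v ≠ 0
  lap_eq : ∀ v, v ≠ T.root → T.lap w₀ f v = T.firstDirichletEigenvalue w₀ * f v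

variable {w₀}

theorem isPerron_of_energy_le {f : V → ℝ} (hf : f T.root = 0) (h0 : ∀ v, 0 ≤ f v)
    (hne : ∃ v, f v ≠ 0)
    (h : T.energy w₀ f ≤ T.firstDirichletEigenvalue w₀ * ∑ v, f v ^ 2) : T.IsPerron w₀ f :=
  ⟨hf, h0, hne, fun _ hv => T.lap_eq_of_energy_eq w₀ f hf
    (h.antisymm (T.firstDirichletEigenvalue_mul_le w₀ f hf)) hv⟩

variable {T}

theorem IsPerron.energy_eq {f : V → ℝ} (hf : T.IsPerron w₀ f) :
    T.energy w₀ f = T.firstDirichletEigenvalue w₀ * ∑ v, f v ^ 2 := by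
  rw [← sum_mul_lap_self, Finset.mul_sum]
  refine Finset.sum_congr rfl fun v _ => ?_
  by_cases hv : v = T.root
  · simp [hv, hf.root]
  · rw [hf.lap_eq v hv]; ring

theorem exists_isPerron (hw : 1 ≤ w₀) : ∃ f, T.IsPerron w₀ f := by
  classical
  obtain ⟨x, hx⟩ := (T.firstDirichletEigenvalue_isLeast w₀).1.exists_hasEigenvector
  have hx1 := Module.End.mem_eigenspace_iff.1 hx.1
  rw [Matrix.toLin'_apply] at hx1
  set f : V → ℝ := fun v => if h : v ≠ T.root then x ⟨v, h⟩ else 0 with hfdef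
  have hfr : f T.root = 0 := by simp [hfdef]
  have hfx : (fun u : {v : V // v ≠ T.root} => f u) = x := by
    ext u
    simp [hfdef, u.2]
  have hE : T.energy w₀ f = T.firstDirichletEigenvalue w₀ * ∑ v, f v ^ 2 := by
    have h1 := T.star_dotProduct_sub_mulVec w₀ f hfr (T.firstDirichletEigenvalue w₀)
    rw [hfx, Matrix.sub_mulVec, Matrix.smul_mulVec, Matrix.one_mulVec, hx1, sub_self,
      dotProduct_zero] at h1
    linarith
  refine ⟨fun v => |f v|, T.isPerron_of_energy_le (by simp [hfr]) (fun v => abs_nonneg _) ?_ ?_⟩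
  · by_contra! hcon
    refine hx.2 ?_
    rw [← hfx]
    ext u
    simpa using hcon u
  · simp only [sq_abs]
    rw [← hE]
    refine Finset.sum_le_sum fun v _ => mul_le_mul_of_nonneg_left ?_ (T.wt_nonneg hw v)
    exact sq_le_sq.2 (abs_abs_sub_abs_le _ _)

end DirichletTree

/-! ### Monotonicity of the first eigenfunction -/

namespace DirichletTree

theorem par_induction {V : Type*} (T : DirichletTree V) {P : V → Prop} (root : P T.root)
    (step : ∀ v, v ≠ T.root → P (T.par v) → P v) (v : V) : P v := by
  induction hn : T.depth v using Nat.strong_induction_on generalizing v with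
  | _ n ih =>
    by_cases hv : v = T.root
    · rwa [hv]
    · have := T.depth_par hv
      exact step v hv (ih _ (by omega) _ rfl)

variable {V : Type*} [Fintype V] {w₀ : ℝ} {T : DirichletTree V}

theorem firstDirichletEigenvalue_pos (hw : 1 ≤ w₀) : 0 < T.firstDirichletEigenvalue w₀ := by
  obtain ⟨f, hf⟩ := exists_isPerron (T := T) hw
  by_contra! hν
  have hE : T.energy w₀ f ≤ 0 := by
    rw [hf.energy_eq]
    exact mul_nonpos_of_nonpos_of_nonneg hν (Finset.sum_nonneg fun v _ => sq_nonneg _)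
  have hterm : ∀ v ∈ Finset.univ, 0 ≤ T.wt w₀ v * (f v - f (T.par v)) ^ 2 := fun v _ =>
    mul_nonneg (T.wt_nonneg hw v) (sq_nonneg _)
  have h0 := (Finset.sum_eq_zero_iff_of_nonneg hterm).1 (hE.antisymm (Finset.sum_nonneg hterm))
  obtain ⟨u, hu⟩ := hf.ne_zero
  refine hu (T.par_induction (P := fun v => f v = 0) hf.root (fun v hv hp => ?_) u)
  have h1 := h0 v (Finset.mem_univ v)
  have h2 := T.one_le_wt hw hv
  rcases mul_eq_zero.1 h1 with h | h
  · linarith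
  · have := pow_eq_zero_iff (two_ne_zero) |>.1 h
    linarith

namespace IsPerron

variable {f : V → ℝ}

theorem flux_eq (hf : T.IsPerron w₀ f) {v : V} (hv : v ≠ T.root) :
    T.wt w₀ v * (f v - f (T.par v)) =
      T.firstDirichletEigenvalue w₀ * f v + ∑ c ∈ T.children v, T.wt w₀ c * (f c - f v) := by
  have := hf.lap_eq v hv
  rw [DirichletTree.lap_eq] at this
  linarith

theorem flux_nonneg (hw : 1 ≤ w₀) (hf : T.IsPerron w₀ f) (v : V) :
    0 ≤ T.wt w₀ v * (f v - f (T.par v)) := by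
  classical
  by_contra! hneg
  -- A deepest vertex with negative flux contradicts the flux balance at that vertex.
  obtain ⟨u, hu, hmax⟩ := Finset.exists_max_image
    (Finset.univ.filter fun v => T.wt w₀ v * (f v - f (T.par v)) < 0) T.depth
    ⟨v, by simpa using hneg⟩
  simp only [Finset.mem_filter, Finset.mem_univ, true_and] at hu hmax
  have hur : u ≠ T.root := by
    rintro rfl
    simp [par_root] at hu
  refine hu.not_ge ?_
  rw [hf.flux_eq hur]
  refine add_nonneg (mul_nonneg (firstDirichletEigenvalue_pos hw).le (hf.nonneg u))
    (Finset.sum_nonneg fun c hc => ?_)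
  rw [mem_children] at hc
  by_contra! hlt
  rw [← hc.2] at hlt
  have h1 := hmax c hlt
  have h2 := T.depth_par hc.1
  rw [hc.2] at h2
  omega

theorem par_le (hw : 1 ≤ w₀) (hf : T.IsPerron w₀ f) (v : V) : f (T.par v) ≤ f v := by
  by_cases hv : v = T.root
  · rw [hv, par_root]
  · have h1 := hf.flux_nonneg hw v
    have h2 := T.one_le_wt hw hv
    have := nonneg_of_mul_nonneg_right h1 (by linarith)
    linarith

theorem par_lt (hw : 1 ≤ w₀) (hf : T.IsPerron w₀ f) {v : V} (hv : 0 < f v) :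
    f (T.par v) < f v := by
  have hvr : v ≠ T.root := by
    rintro rfl
    exact hv.ne' hf.root
  have h1 : 0 < T.wt w₀ v * (f v - f (T.par v)) := by
    rw [hf.flux_eq hvr]
    refine add_pos_of_pos_of_nonneg (mul_pos (firstDirichletEigenvalue_pos hw) hv)
      (Finset.sum_nonneg fun c hc => ?_)
    have := hf.flux_nonneg hw c
    rwa [(T.mem_children.1 hc).2] at this
  have h2 := T.one_le_wt hw hvr
  have := pos_of_mul_pos_right h1 (by linarith)
  linarith

/-- A nonnegative eigenfunction that vanishes at an interior vertex vanishes below it. -/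
theorem par_pos (hw : 1 ≤ w₀) (hf : T.IsPerron w₀ f) {v : V} (hv : 0 < f v)
    (hp : T.par v ≠ T.root) : 0 < f (T.par v) := by
  have hvr : v ≠ T.root := by
    rintro rfl
    exact hv.ne' hf.root
  refine lt_of_le_of_ne (hf.nonneg _) fun h0 => ?_
  have h1 := hf.flux_eq hp
  rw [← h0, mul_zero, zero_add] at h1
  have h2 : 0 < ∑ c ∈ T.children (T.par v), T.wt w₀ c * (f c - 0) := by
    refine Finset.sum_pos' (fun c _ => ?_) ⟨v, T.mem_children.2 ⟨hvr, rfl⟩, ?_⟩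
    · exact mul_nonneg (T.wt_nonneg hw c) (by linarith [hf.nonneg c])
    · exact mul_pos (by linarith [T.one_le_wt hw hvr]) (by linarith)
  have h3 := mul_nonneg (T.wt_nonneg hw (T.par v)) (hf.nonneg (T.par (T.par v)))
  linarith

/-- The value at a pendant vertex is determined by the value at its neighbour. -/
theorem pendant_eq (hw : 1 ≤ w₀) (hf : T.IsPerron w₀ f) (hν : T.firstDirichletEigenvalue w₀ < 1)
    {q : V} (hq : q ≠ T.root) (h1 : T.degree q = 1) :
    f q = (1 - T.firstDirichletEigenvalue w₀)⁻¹ * f (T.par q) := by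
  have h := hf.flux_eq hq
  rw [T.children_eq_empty hq h1, Finset.sum_empty, add_zero] at h
  by_cases hp : T.par q = T.root
  · rw [hp, hf.root, sub_zero] at h
    have h2 := T.one_le_wt hw hq
    have : (T.wt w₀ q - T.firstDirichletEigenvalue w₀) * f q = 0 := by linarith
    rcases mul_eq_zero.1 this with h3 | h3
    · linarith
    · rw [hp, hf.root, h3, mul_zero]
  · rw [T.wt_of_par_ne w₀ hq hp] at h
    have : (1 - T.firstDirichletEigenvalue w₀) ≠ 0 := by linarith
    field_simp
    linarith

end IsPerron

/-! ### Elimination of the pendant vertices -/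

variable (T) in
open Classical in
/-- The non-pendant vertices other than the root. -/
noncomputable def inner : Finset V := {v | v ≠ T.root ∧ T.degree v ≠ 1}

theorem mem_inner {v : V} : v ∈ T.inner ↔ v ≠ T.root ∧ T.degree v ≠ 1 := by
  simp [inner]

variable (T) in
open Classical in
/-- The pendant vertices other than the root. -/
noncomputable def pendants : Finset V := {v | v ≠ T.root ∧ T.degree v = 1}

theorem mem_pendants {v : V} : v ∈ T.pendants ↔ v ≠ T.root ∧ T.degree v = 1 := by
  simp [pendants]

theorem par_mem_inner {v : V} (hv : v ≠ T.root) (hp : T.par v ≠ T.root) : T.par v ∈ T.inner :=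
  mem_inner.2 ⟨hp, T.degree_par_ne_one hv hp⟩

theorem exists_pendant_of_inner_nonempty (h : T.inner.Nonempty) :
    ∃ q, q ≠ T.root ∧ T.degree q = 1 ∧ T.par q ≠ T.root := by
  obtain ⟨u, hu, hmax⟩ := Finset.exists_max_image T.inner T.depth h
  rw [mem_inner] at hu
  obtain ⟨c, hc⟩ := T.children_nonempty hu.1 hu.2
  rw [mem_children] at hc
  refine ⟨c, hc.1, ?_, hc.2 ▸ hu.1⟩
  by_contra hd
  have h1 := hmax c (mem_inner.2 ⟨hc.1, hd⟩)
  have h2 := T.depth_par hc.1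
  rw [hc.2] at h2
  omega

open Classical in
/-- The indicator of a pendant vertex `q` has energy `wt q`. -/
theorem energy_single {q : V} (hq : q ≠ T.root) (h1 : T.degree q = 1) :
    T.energy w₀ (Pi.single q 1) = T.wt w₀ q := by
  rw [← sum_mul_lap_self, Finset.sum_eq_single q (fun v _ hv => by simp [hv]) (by simp),
    DirichletTree.lap_eq, T.children_eq_empty hq h1]
  simp [T.par_ne hq]

theorem firstDirichletEigenvalue_le_wt {q : V} (hq : q ≠ T.root) (h1 : T.degree q = 1) :
    T.firstDirichletEigenvalue w₀ ≤ T.wt w₀ q := by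
  classical
  have h := T.firstDirichletEigenvalue_mul_le w₀ (Pi.single q 1) (by simp [hq.symm])
  rw [energy_single hq h1] at h
  simpa [Pi.single_apply] using h

theorem firstDirichletEigenvalue_lt_one (h : T.inner.Nonempty) :
    T.firstDirichletEigenvalue w₀ < 1 := by
  classical
  obtain ⟨q, hq, h1, hp⟩ := exists_pendant_of_inner_nonempty h
  have hwt := T.wt_of_par_ne w₀ hq hp
  have hle := firstDirichletEigenvalue_le_wt (w₀ := w₀) hq h1
  rw [hwt] at hle
  refine lt_of_le_of_ne hle fun heq => ?_
  -- Otherwise the indicator of `q` would be an eigenfunction, but it is not one at `par q`.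
  have h2 := T.lap_eq_of_energy_eq w₀ (Pi.single q 1) (by simp [hq.symm])
    (by rw [energy_single hq h1, hwt, heq]; simp [Pi.single_apply]) hp
  have hqc : q ∈ T.children (T.par q) := T.mem_children.2 ⟨hq, rfl⟩
  have hpp : T.par (T.par q) ≠ q := T.not_par_par hq rfl hp
  rw [DirichletTree.lap_eq] at h2
  simp only [Pi.single_eq_of_ne (T.par_ne hq), Pi.single_eq_of_ne hpp, sub_zero, mul_zero,
    zero_sub, neg_eq_zero] at h2
  rw [Finset.sum_eq_single q (fun c _ hc => by simp [hc]) (fun h => absurd hqc h), hwt] at h2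
  simp at h2

/-- For a tree without inner vertices the first eigenvalue is one of the edge weights. -/
theorem exists_wt_eq_firstDirichletEigenvalue (hw : 1 ≤ w₀) (h : T.inner = ∅) :
    ∃ q, q ≠ T.root ∧ T.firstDirichletEigenvalue w₀ = T.wt w₀ q := by
  obtain ⟨f, hf⟩ := exists_isPerron (T := T) hw
  obtain ⟨q, hq⟩ := hf.ne_zero
  have hqr : q ≠ T.root := by
    rintro rfl
    exact hq hf.root
  have hd : T.degree q = 1 := by
    by_contra hd
    have : q ∈ T.inner := mem_inner.2 ⟨hqr, hd⟩
    simp [h] at this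
  have hp : T.par q = T.root := by
    by_contra hp
    have := par_mem_inner hqr hp
    simp [h] at this
  have h1 := hf.flux_eq hqr
  rw [T.children_eq_empty hqr hd, hp, hf.root, sub_zero, Finset.sum_empty, add_zero] at h1
  exact ⟨q, hqr, (mul_right_cancel₀ hq h1).symm⟩

theorem sum_eq_inner_add_pendants (φ : V → ℝ) (h : φ T.root = 0) :
    ∑ v, φ v = ∑ v ∈ T.inner, φ v + ∑ v ∈ T.pendants, φ v := by
  classical
  have hd : Disjoint T.inner T.pendants := Finset.disjoint_left.2 fun v h1 h2 =>
    (mem_inner.1 h1).2 (mem_pendants.1 h2).2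
  rw [← Finset.sum_union hd]
  refine (Finset.sum_subset (Finset.subset_univ _) fun v _ hv => ?_).symm
  have : v = T.root := by
    simp only [Finset.mem_union, mem_inner, mem_pendants] at hv
    tauto
  rw [this, h]

/-- The quadratic form `energy h - ν ‖h‖²` for a function whose values at the pendant vertices are
eliminated by `h q = κ * h (par q)`, where `κ = (1 - ν)⁻¹`. -/
theorem energy_sub_eq {h : V → ℝ} {ν κ : ℝ} (hr : h T.root = 0) (hκ : κ * (1 - ν) = 1)
    (hp : ∀ q, q ≠ T.root → T.degree q = 1 → h q = κ * h (T.par q)) :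
    T.energy w₀ h - ν * ∑ v, h v ^ 2 = ∑ v ∈ T.inner, T.wt w₀ v * (h v - h (T.par v)) ^ 2 -
      ν * (∑ v ∈ T.inner, h v ^ 2 + κ * (∑ v ∈ T.inner, ((T.degree v : ℝ) - 2) * h v ^ 2 +
        ∑ v ∈ T.inner, (h v ^ 2 - h (T.par v) ^ 2))) := by
  classical
  have h1 : T.energy w₀ h - ν * ∑ v, h v ^ 2 =
      ∑ v, (T.wt w₀ v * (h v - h (T.par v)) ^ 2 - ν * h v ^ 2) := by
    rw [energy, Finset.mul_sum, Finset.sum_sub_distrib]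
  have h2 : ∑ v ∈ T.pendants,
      (T.wt w₀ v * (h v - h (T.par v)) ^ 2 - ν * h v ^ 2) =
      -(ν * κ) * ∑ v ∈ T.pendants, h (T.par v) ^ 2 := by
    rw [Finset.mul_sum]
    refine Finset.sum_congr rfl fun q hq => ?_
    obtain ⟨hq1, hq2⟩ := mem_pendants.1 hq
    rw [hp q hq1 hq2]
    by_cases hpr : T.par q = T.root
    · rw [hpr, hr]; ring
    · rw [T.wt_of_par_ne w₀ hq1 hpr]
      linear_combination (h (T.par q) ^ 2 * (κ - 1)) * hκ
  have h3 : ∑ c, h (T.par c) ^ 2 = ∑ v ∈ T.inner, ((T.degree v : ℝ) - 1) * h v ^ 2 := by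
    have h4 := T.sum_par (fun v _ => h v ^ 2)
    have h6 : ∑ c with c ≠ T.root, h (T.par c) ^ 2 = ∑ c, h (T.par c) ^ 2 :=
      Finset.sum_filter_of_ne fun c _ hc h0 => hc (by rw [h0, par_root, hr]; ring)
    rw [h6] at h4
    rw [← h4, sum_eq_inner_add_pendants (T := T) _ (by simp [hr]),
      Finset.sum_eq_zero (s := T.pendants), add_zero]
    · refine Finset.sum_congr rfl fun v hv => ?_
      have := T.degree_eq_card_children v
      rw [if_neg (mem_inner.1 hv).1] at this
      rw [this]
      simp
    · intro q hq
      rw [T.children_eq_empty (mem_pendants.1 hq).1 (mem_pendants.1 hq).2, Finset.sum_empty]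
  rw [sum_eq_inner_add_pendants _ (by rw [par_root, hr]; ring)] at h3
  rw [h1, sum_eq_inner_add_pendants _ (by rw [par_root, hr]; ring), h2, Finset.sum_sub_distrib,
    Finset.sum_sub_distrib, ← Finset.mul_sum]
  have h5 : ∑ v ∈ T.inner, ((T.degree v : ℝ) - 1) * h v ^ 2 =
      ∑ v ∈ T.inner, ((T.degree v : ℝ) - 2) * h v ^ 2 + ∑ v ∈ T.inner, h v ^ 2 := by
    rw [← Finset.sum_add_distrib]
    exact Finset.sum_congr rfl fun v _ => by ring
  rw [h5] at h3
  linear_combination (-(ν * κ)) * h3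

end DirichletTree

/-! ### Comparison of two trees -/

namespace DirichletTree

variable {V : Type*} [Fintype V] {w₀ : ℝ} {T : DirichletTree V}

variable (T) in
/-- `v 0, …, v k` is a descending path from the root that runs through all non-pendant vertices
and along which the degrees are non-decreasing from `v 1` on. Only `v 0, …, v k` matter. -/
structure IsSortedSpine (k : ℕ) (v : ℕ → V) : Prop where
  zero : v 0 = T.root
  mem_iff : ∀ u, u ∈ T.inner ↔ ∃ j < k, v (j + 1) = u
  par : ∀ j < k, T.par (v (j + 1)) = v j
  mono : ∀ i j, i ≤ j → j < k → T.degree (v (i + 1)) ≤ T.degree (v (j + 1))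

namespace IsSortedSpine

variable {k : ℕ} {v : ℕ → V}

theorem ne_root (hv : T.IsSortedSpine k v) {j : ℕ} (hj : j < k) : v (j + 1) ≠ T.root :=
  (mem_inner.1 ((hv.mem_iff _).2 ⟨j, hj, rfl⟩)).1

theorem degree_ne_one (hv : T.IsSortedSpine k v) {j : ℕ} (hj : j < k) : T.degree (v (j + 1)) ≠ 1 :=
  (mem_inner.1 ((hv.mem_iff _).2 ⟨j, hj, rfl⟩)).2

theorem depth_eq (hv : T.IsSortedSpine k v) {j : ℕ} (hj : j ≤ k) : T.depth (v j) = j := by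
  induction j with
  | zero => rw [hv.zero]; exact SimpleGraph.dist_self
  | succ j ih => rw [T.depth_par (hv.ne_root hj), hv.par j hj, ih (by omega)]

theorem injOn (hv : T.IsSortedSpine k v) : Set.InjOn v (Set.Iic k) := fun i hi j hj h => by
  rw [← hv.depth_eq hi, ← hv.depth_eq hj, h]

theorem sum_inner (hv : T.IsSortedSpine k v) (φ : V → ℝ) :
    ∑ u ∈ T.inner, φ u = ∑ j ∈ Finset.range k, φ (v (j + 1)) := by
  classical
  have : T.inner = (Finset.range k).image fun j => v (j + 1) := by
    ext u
    simp [hv.mem_iff]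
  rw [this, Finset.sum_image]
  intro i hi j hj h
  have := hv.injOn (Set.mem_Iic.2 (Nat.succ_le_of_lt (Finset.mem_range.1 hi)))
    (Set.mem_Iic.2 (Nat.succ_le_of_lt (Finset.mem_range.1 hj))) h
  omega

end IsSortedSpine

/-- The rearrangement inequality in the form used for degrees, together with its equality case. -/
theorem sum_perm_mul_le {k : ℕ} {D D' Φ : ℕ → ℝ} (σ : Equiv.Perm (Fin k))
    (hσ : ∀ j : Fin k, D' j = D (σ j)) (hD : ∀ i j, i ≤ j → j < k → D i ≤ D j)
    (hΦ : ∀ i j, i ≤ j → j < k → Φ i ≤ Φ j) :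
    ∑ j ∈ Finset.range k, D' j * Φ j ≤ ∑ j ∈ Finset.range k, D j * Φ j ∧
      (∑ j ∈ Finset.range k, D' j * Φ j = ∑ j ∈ Finset.range k, D j * Φ j →
        (∀ i j, i < j → j < k → Φ i < Φ j) → ∀ i j, i ≤ j → j < k → D' i ≤ D' j) := by
  have hmv : Monovary (fun j : Fin k => D j) (fun j : Fin k => Φ j) := by
    refine Monotone.monovary (fun i j h => hD i j h j.2) (fun i j h => hΦ i j h j.2)
  rw [Finset.sum_range, Finset.sum_range]
  simp_rw [hσ]
  refine ⟨hmv.sum_comp_perm_mul_le_sum_mul, fun heq hlt i j hij hj => ?_⟩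
  have := hmv.sum_comp_perm_mul_eq_sum_mul_iff.1 heq
  rcases hij.eq_or_lt with rfl | hij
  · exact le_rfl
  · have h1 := @this ⟨i, hij.trans hj⟩ ⟨j, hj⟩ (hlt i j hij hj)
    have h2 := hσ ⟨i, hij.trans hj⟩
    have h3 := hσ ⟨j, hj⟩
    simp only [Function.comp_apply] at h1
    simp only at h2 h3
    rwa [h2, h3]

/-- The numerical core of the comparison. `a j` and `b j` are the values of an eigenfunction at the
`j`-th inner vertex and at its parent, `F` collects the increments `a j - b j`; `D'` and `D` are the
degrees (minus `2`), `W'` and `W` the edge weights in the two trees. -/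
theorem reduced_form_comparison {k : ℕ} {a b F D D' W W' : ℕ → ℝ} {ν κ : ℝ} (hν : 0 < ν)
    (hκ : 0 < κ) (hF : ∀ j, F (j + 1) = F j + (a j - b j))
    (hb : ∀ j < k, 0 ≤ b j) (hba : ∀ j < k, b j ≤ a j) (hbF : ∀ j < k, b j ≤ F j)
    (σ : Equiv.Perm (Fin k)) (hσ : ∀ j : Fin k, D' j = D (σ j))
    (hD : ∀ i j, i ≤ j → j < k → D i ≤ D j) (hD0 : ∀ j < k, 0 ≤ D' j)
    (hW : ∀ j < k, W j * (a j - b j) ^ 2 ≤ W' j * (a j - b j) ^ 2)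
    (heq : ∑ j ∈ Finset.range k, W' j * (a j - b j) ^ 2 - ν * (∑ j ∈ Finset.range k, a j ^ 2 +
      κ * (∑ j ∈ Finset.range k, D' j * a j ^ 2 +
        ∑ j ∈ Finset.range k, (a j ^ 2 - b j ^ 2))) = 0) :
    let R := ∑ j ∈ Finset.range k, W j * (F (j + 1) - F j) ^ 2 -
      ν * (∑ j ∈ Finset.range k, F (j + 1) ^ 2 +
      κ * (∑ j ∈ Finset.range k, D j * F (j + 1) ^ 2 +
        ∑ j ∈ Finset.range k, (F (j + 1) ^ 2 - F j ^ 2)))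
    R ≤ 0 ∧ (R = 0 → (∀ j < k, a j = F (j + 1)) ∧
      (∀ j < k, W j * (a j - b j) ^ 2 = W' j * (a j - b j) ^ 2) ∧
      ((∀ j < k, F j < F (j + 1)) → ∀ i j, i ≤ j → j < k → D' i ≤ D' j)) := by
  intro R
  have haF : ∀ j < k, a j ≤ F (j + 1) := fun j hj => by
    have := hbF j hj
    rw [hF]; linarith
  have ha : ∀ j < k, 0 ≤ a j := fun j hj => (hb j hj).trans (hba j hj)
  have hsq : ∀ j < k, a j ^ 2 ≤ F (j + 1) ^ 2 := fun j hj =>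
    pow_le_pow_left₀ (ha j hj) (haF j hj) 2
  have hmono : ∀ i j, i ≤ j → j < k → F (i + 1) ≤ F (j + 1) := by
    intro i j hij hj
    induction j, hij using Nat.le_induction with
    | base => exact le_rfl
    | succ j hij ih =>
      have := hba (j + 1) hj
      have h2 := ih (by omega)
      rw [hF (j + 1)]; linarith
  have hrear := sum_perm_mul_le (Φ := fun j => F (j + 1) ^ 2) σ hσ hD fun i j hij hj =>
    pow_le_pow_left₀ ((ha i (by omega)).trans (haF i (by omega))) (hmono i j hij hj) 2
  have hW' : ∀ j ∈ Finset.range k, W j * (F (j + 1) - F j) ^ 2 ≤ W' j * (a j - b j) ^ 2 := by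
    intro j hj
    have : F (j + 1) - F j = a j - b j := by rw [hF]; ring
    rw [this]
    exact hW j (Finset.mem_range.1 hj)
  have s0 := Finset.sum_le_sum hW'
  have hs1 : ∀ j ∈ Finset.range k, a j ^ 2 ≤ F (j + 1) ^ 2 := fun j hj =>
    hsq j (Finset.mem_range.1 hj)
  have s1 := Finset.sum_le_sum hs1
  have s2 : ∑ j ∈ Finset.range k, D' j * a j ^ 2 ≤ ∑ j ∈ Finset.range k, D' j * F (j + 1) ^ 2 :=
    Finset.sum_le_sum fun j hj => mul_le_mul_of_nonneg_left (hs1 j hj)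
      (hD0 j (Finset.mem_range.1 hj))
  have s3 := hrear.1
  have s4 : ∑ j ∈ Finset.range k, (a j ^ 2 - b j ^ 2) ≤
      ∑ j ∈ Finset.range k, (F (j + 1) ^ 2 - F j ^ 2) := by
    refine Finset.sum_le_sum fun j hj => ?_
    have hj := Finset.mem_range.1 hj
    have h1 := haF j hj
    have h2 := hbF j hj
    have h3 := hba j hj
    have : F (j + 1) ^ 2 - F j ^ 2 - (a j ^ 2 - b j ^ 2) =
        (a j - b j) * (F (j + 1) - a j + (F j - b j)) := by rw [hF]; ring
    have := mul_nonneg (sub_nonneg.2 h3) (add_nonneg (sub_nonneg.2 h1) (sub_nonneg.2 h2))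
    linarith
  set A0 := ∑ j ∈ Finset.range k, W j * (F (j + 1) - F j) ^ 2
  set A1 := ∑ j ∈ Finset.range k, F (j + 1) ^ 2
  set A2 := ∑ j ∈ Finset.range k, D j * F (j + 1) ^ 2
  set A3 := ∑ j ∈ Finset.range k, (F (j + 1) ^ 2 - F j ^ 2)
  set B0 := ∑ j ∈ Finset.range k, W' j * (a j - b j) ^ 2
  set B1 := ∑ j ∈ Finset.range k, a j ^ 2
  set B2 := ∑ j ∈ Finset.range k, D' j * a j ^ 2
  set B3 := ∑ j ∈ Finset.range k, (a j ^ 2 - b j ^ 2)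
  have hR : R = -(B0 - A0) - ν * ((A1 - B1) + κ * ((A2 - B2) + (A3 - B3))) := by
    have : R = A0 - ν * (A1 + κ * (A2 + A3)) := rfl
    rw [this]
    linear_combination heq
  have t1 : 0 ≤ A1 - B1 := by linarith
  have t2 : 0 ≤ κ * ((A2 - B2) + (A3 - B3)) := mul_nonneg hκ.le (by linarith)
  have t3 : 0 ≤ ν * ((A1 - B1) + κ * ((A2 - B2) + (A3 - B3))) := mul_nonneg hν.le (by linarith)
  refine ⟨by linarith, fun hR0 => ?_⟩
  have e3 : ν * ((A1 - B1) + κ * ((A2 - B2) + (A3 - B3))) = 0 := by linarith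
  have e4 : (A1 - B1) + κ * ((A2 - B2) + (A3 - B3)) = 0 :=
    (mul_eq_zero.1 e3).resolve_left hν.ne'
  have e5 : κ * ((A2 - B2) + (A3 - B3)) = 0 := by linarith
  have e6 : (A2 - B2) + (A3 - B3) = 0 := (mul_eq_zero.1 e5).resolve_left hκ.ne'
  have e0 : A0 = B0 := by linarith
  have e1 : B1 = A1 := by linarith
  have hterm1 := (Finset.sum_eq_sum_iff_of_le hs1).1 e1
  have hterm0 := (Finset.sum_eq_sum_iff_of_le hW').1 e0
  refine ⟨fun j hj => ?_, fun j hj => ?_, fun hlt => ?_⟩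
  · exact (pow_left_inj₀ (ha j hj) ((ha j hj).trans (haF j hj)) two_ne_zero).1
      (hterm1 j (Finset.mem_range.2 hj))
  · have := hterm0 j (Finset.mem_range.2 hj)
    rwa [show F (j + 1) - F j = a j - b j by rw [hF]; ring] at this
  · refine hrear.2 (by linarith) fun i j hij hj => ?_
    refine pow_lt_pow_left₀ ?_ ((ha i (by omega)).trans (haF i (by omega))) two_ne_zero
    obtain ⟨m, rfl⟩ : ∃ m, j = m + 1 := ⟨j - 1, by omega⟩
    exact (hmono i m (by omega) (by omega)).trans_lt (hlt _ hj)

end DirichletTree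

namespace DirichletTree

variable {V : Type*} [Fintype V] {w₀ : ℝ} {T : DirichletTree V}

section TestFunction

variable {k : ℕ} {v : ℕ → V}

open Classical in
variable (T) in
/-- The function with value `F j` at the `j`-th vertex of a spine, extended to the pendant vertices
by the factor `κ`. Positions on the spine are read off from the depth. -/
noncomputable def spineFunction (κ : ℝ) (F : ℕ → ℝ) (u : V) : ℝ :=
  if u ∈ T.pendants then κ * F (T.depth u - 1) else F (T.depth u)

theorem IsSortedSpine.spineFunction_apply (hv : T.IsSortedSpine k v) (κ : ℝ) (F : ℕ → ℝ) {j : ℕ}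
    (hj : j ≤ k) : T.spineFunction κ F (v j) = F j := by
  have : v j ∉ T.pendants := by
    rw [mem_pendants]
    rintro ⟨h1, h2⟩
    cases j with
    | zero => exact h1 hv.zero
    | succ j => exact hv.degree_ne_one hj h2
  rw [spineFunction, if_neg this, hv.depth_eq hj]

theorem spineFunction_pendant (κ : ℝ) (F : ℕ → ℝ) (q : V) (hq : q ≠ T.root)
    (h1 : T.degree q = 1) :
    T.spineFunction κ F q = κ * T.spineFunction κ F (T.par q) := by
  have hp : T.par q ∉ T.pendants := by
    rw [mem_pendants]
    rintro ⟨h2, h3⟩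
    exact T.degree_par_ne_one hq h2 h3
  rw [spineFunction, if_pos (mem_pendants.2 ⟨hq, h1⟩), spineFunction, if_neg hp, T.depth_par hq,
    Nat.add_sub_cancel]

theorem IsSortedSpine.energy_spineFunction_sub (hv : T.IsSortedSpine k v) {κ ν : ℝ} {F : ℕ → ℝ}
    (hF : F 0 = 0) (hκ : κ * (1 - ν) = 1) :
    T.energy w₀ (T.spineFunction κ F) - ν * ∑ u, T.spineFunction κ F u ^ 2 =
      ∑ j ∈ Finset.range k, T.wt w₀ (v (j + 1)) * (F (j + 1) - F j) ^ 2 -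
      ν * (∑ j ∈ Finset.range k, F (j + 1) ^ 2 +
      κ * (∑ j ∈ Finset.range k, ((T.degree (v (j + 1)) : ℝ) - 2) * F (j + 1) ^ 2 +
        ∑ j ∈ Finset.range k, (F (j + 1) ^ 2 - F j ^ 2))) := by
  have h0 : T.spineFunction κ F T.root = 0 := by
    rw [← hv.zero, hv.spineFunction_apply κ F (Nat.zero_le k), hF]
  rw [energy_sub_eq h0 hκ fun q => spineFunction_pendant κ F q]
  simp only [hv.sum_inner]
  have e1 : ∀ j ∈ Finset.range k, T.spineFunction κ F (v (j + 1)) = F (j + 1) := fun j hj =>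
    hv.spineFunction_apply κ F (Finset.mem_range.1 hj)
  have e2 : ∀ j ∈ Finset.range k, T.spineFunction κ F (T.par (v (j + 1))) = F j := fun j hj => by
    have hj := Finset.mem_range.1 hj
    rw [hv.par j hj, hv.spineFunction_apply κ F hj.le]
  congr 1
  · exact Finset.sum_congr rfl fun j hj => by rw [e1 j hj, e2 j hj]
  · congr 2
    · exact Finset.sum_congr rfl fun j hj => by rw [e1 j hj]
    · congr 2
      · exact Finset.sum_congr rfl fun j hj => by rw [e1 j hj]
      · exact Finset.sum_congr rfl fun j hj => by rw [e1 j hj, e2 j hj]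

end TestFunction

/-- A tree with a sorted spine minimizes the first eigenvalue: if `w` lists the inner vertices of
`T'` (and possibly its root) with parents first and with the same degrees as the spine of `T`, then
an eigenfunction of `T'` is turned into a test function on `T` by adding up its increments along the
list. In the case of equality this test function is an eigenfunction of `T`, hence strictly
increasing, and all estimates are sharp, so that `w` is a sorted spine of `T'`. -/
theorem IsSortedSpine.firstDirichletEigenvalue_le {T' : DirichletTree V} {k : ℕ} {v w : ℕ → V}
    (hw₀ : 1 ≤ w₀) (hv : T.IsSortedSpine k v) (hν : T'.firstDirichletEigenvalue w₀ < 1)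
    (hinj : Set.InjOn w (Set.Iio k)) (hmem : ∀ u ∈ T'.inner, ∃ j < k, w j = u)
    (hpar : ∀ i < k, ∀ j < k, w j ≠ T'.root → T'.par (w j) = w i → i < j)
    (σ : Equiv.Perm (Fin k)) (hσ : ∀ j : Fin k, T'.degree (w j) = T.degree (v (σ j + 1)))
    (hwt : 0 < k → w 0 ≠ T'.root → T.wt w₀ (v 1) ≤ T'.wt w₀ (w 0)) :
    T.firstDirichletEigenvalue w₀ ≤ T'.firstDirichletEigenvalue w₀ ∧
      (T.firstDirichletEigenvalue w₀ = T'.firstDirichletEigenvalue w₀ →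
        T'.IsSortedSpine k (fun j => if j = 0 then T'.root else w (j - 1)) ∧
        (0 < k → T'.wt w₀ (w 0) = T.wt w₀ (v 1))) := by
  classical
  obtain ⟨f, hf⟩ := exists_isPerron (T := T') hw₀
  have hν0 := firstDirichletEigenvalue_pos (T := T') hw₀
  set ν := T'.firstDirichletEigenvalue w₀ with hνdef
  set κ := (1 - ν)⁻¹ with hκdef
  have hκ : κ * (1 - ν) = 1 := inv_mul_cancel₀ (by linarith)
  have hκ0 : 0 < κ := inv_pos.2 (by linarith)
  set a : ℕ → ℝ := fun j => f (w j) with hadef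
  set b : ℕ → ℝ := fun j => f (T'.par (w j)) with hbdef
  set F : ℕ → ℝ := fun j => ∑ i ∈ Finset.range j, (a i - b i) with hFdef
  have hF0 : F 0 = 0 := Finset.sum_range_zero _
  have hF : ∀ j, F (j + 1) = F j + (a j - b j) := fun j => Finset.sum_range_succ _ _
  have hba : ∀ j, b j ≤ a j := fun j => hf.par_le hw₀ (w j)
  have hFmono : Monotone F := monotone_nat_of_le_succ fun j => by
    have := hba j
    rw [hF]; linarith
  have hF_nonneg : ∀ j, 0 ≤ F j := fun j => hF0 ▸ hFmono (Nat.zero_le j)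
  have hdeg : ∀ j < k, T'.degree (w j) ≠ 1 := fun j hj => by
    rw [hσ ⟨j, hj⟩]
    exact hv.degree_ne_one (σ ⟨j, hj⟩).2
  -- The parent of an inner vertex is the root or occurs earlier in the list.
  have hbF : ∀ j < k, b j ≤ F j := by
    intro j
    induction j using Nat.strong_induction_on with
    | _ j ih =>
      intro hj
      by_cases hr : w j = T'.root
      · simpa [hbdef, hr, par_root, hf.root] using hF_nonneg j
      by_cases hp : T'.par (w j) = T'.root
      · simpa [hbdef, hp, hf.root] using hF_nonneg j
      · obtain ⟨i, hi, hwi⟩ := hmem _ (par_mem_inner hr hp)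
        have hij := hpar i hi j hj hr hwi.symm
        have h1 := ih i hij hi
        have h2 : b j = a i := by simp only [hbdef, hadef, hwi]
        have h3 : F (i + 1) ≤ F j := hFmono hij
        rw [hF] at h3
        linarith
  have haF : ∀ j < k, a j ≤ F (j + 1) := fun j hj => by
    have := hbF j hj
    rw [hF]; linarith
  have hsum : ∀ φ : V → ℝ, φ T'.root = 0 →
      ∑ u ∈ T'.inner, φ u = ∑ j ∈ Finset.range k, φ (w j) := by
    intro φ hφ
    rw [← Finset.sum_image (s := Finset.range k) (g := w) (f := φ)
      (fun i hi j hj h => hinj (by simpa using hi) (by simpa using hj) h)]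
    refine Finset.sum_subset (fun u hu => ?_) fun u hu hu' => ?_
    · obtain ⟨j, hj, rfl⟩ := hmem u hu
      exact Finset.mem_image_of_mem _ (Finset.mem_range.2 hj)
    · obtain ⟨j, hj, rfl⟩ := Finset.mem_image.1 hu
      have : w j = T'.root := by
        by_contra hr
        exact hu' (mem_inner.2 ⟨hr, hdeg j (Finset.mem_range.1 hj)⟩)
      rw [this, hφ]
  have heq := energy_sub_eq (w₀ := w₀) hf.root hκ fun q hq h1 => hf.pendant_eq hw₀ hν hq h1
  rw [hf.energy_eq, ← hνdef, sub_self, hsum _ (by rw [par_root]; ring), hsum _ (by simp [hf.root]),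
    hsum _ (by simp [hf.root]), hsum _ (by rw [par_root]; ring)] at heq
  have hW : ∀ j < k, T.wt w₀ (v (j + 1)) * (a j - b j) ^ 2 ≤
      T'.wt w₀ (w j) * (a j - b j) ^ 2 := by
    intro j hj
    by_cases hr : w j = T'.root
    · simp [hadef, hbdef, hr, par_root]
    refine mul_le_mul_of_nonneg_right ?_ (sq_nonneg _)
    cases j with
    | zero => exact hwt hj hr
    | succ j =>
      rw [T.wt_of_par_ne w₀ (hv.ne_root hj) (hv.par _ hj ▸ hv.ne_root (by omega))]
      exact T'.one_le_wt hw₀ hr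
  have hcore := reduced_form_comparison (a := a) (b := b) (F := F)
    (D := fun j => (T.degree (v (j + 1)) : ℝ) - 2) (D' := fun j => (T'.degree (w j) : ℝ) - 2)
    (W := fun j => T.wt w₀ (v (j + 1))) (W' := fun j => T'.wt w₀ (w j)) hν0 hκ0 hF
    (fun j _ => hf.nonneg _) (fun j _ => hba j) hbF σ (fun j => by simp [hσ j])
    (fun i j hij hj => by
      have := hv.mono i j hij hj
      have : (T.degree (v (i + 1)) : ℝ) ≤ T.degree (v (j + 1)) := by exact_mod_cast this
      simpa using this)
    (fun j hj => by
      have h1 := T'.degree_pos (w j)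
      have h2 := hdeg j hj
      have : 2 ≤ T'.degree (w j) := by omega
      have : (2 : ℝ) ≤ T'.degree (w j) := by exact_mod_cast this
      linarith) hW heq.symm
  simp only at hcore
  rw [← hv.energy_spineFunction_sub hF0 hκ] at hcore
  set h := T.spineFunction κ F with hhdef
  have hh0 : h T.root = 0 := by
    rw [← hv.zero, hhdef, hv.spineFunction_apply κ F (Nat.zero_le k), hF0]
  have hhnn : ∀ u, 0 ≤ h u := fun u => by
    rw [hhdef, spineFunction]
    split_ifs
    · exact mul_nonneg hκ0.le (hF_nonneg _)
    · exact hF_nonneg _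
  -- The eigenfunction does not vanish at all inner vertices, hence the test function is not zero.
  have hFk : 0 < F k := by
    have hex : ∃ u ∈ T'.inner, 0 < f u := by
      obtain ⟨u, hu⟩ := hf.ne_zero
      have hur : u ≠ T'.root := by
        rintro rfl
        exact hu hf.root
      have hu0 := lt_of_le_of_ne (hf.nonneg u) (Ne.symm hu)
      by_cases h1 : T'.degree u = 1
      · have h2 := hf.pendant_eq hw₀ hν hur h1
        have hpr : T'.par u ≠ T'.root := by
          intro hpr
          rw [hpr, hf.root, mul_zero] at h2
          exact hu h2
        exact ⟨_, par_mem_inner hur hpr, hf.par_pos hw₀ hu0 hpr⟩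
      · exact ⟨u, mem_inner.2 ⟨hur, h1⟩, hu0⟩
    obtain ⟨u, hu, hu0⟩ := hex
    obtain ⟨j, hj, rfl⟩ := hmem u hu
    exact hu0.trans_le ((haF j hj).trans (hFmono hj))
  have hhne : ∃ u, h u ≠ 0 := ⟨v k, by
    rw [hhdef, hv.spineFunction_apply κ F le_rfl]; exact hFk.ne'⟩
  have hS : 0 < ∑ u, h u ^ 2 := by
    obtain ⟨u, hu⟩ := hhne
    exact Finset.sum_pos' (fun u _ => sq_nonneg _) ⟨u, Finset.mem_univ u, by positivity⟩
  have hRay := T.firstDirichletEigenvalue_mul_le w₀ h hh0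
  have hle : T.firstDirichletEigenvalue w₀ ≤ ν := by
    refine le_of_mul_le_mul_right ?_ hS
    linarith [hcore.1]
  refine ⟨hle, fun hνeq => ?_⟩
  rw [hνeq] at hRay
  have hh : T.IsPerron w₀ h := T.isPerron_of_energy_le hh0 hhnn hhne (by
    rw [hνeq]; linarith [hcore.1])
  obtain ⟨haeq, hWeq, hsorted⟩ := hcore.2 (by linarith [hcore.1])
  -- Going down the spine, positivity and strict monotonicity of `F` follow.
  have hFpos : ∀ m j, j + 1 + m = k → 0 < F (j + 1) := by
    intro m
    induction m with
    | zero => rintro j rfl; exact hFk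
    | succ m ih =>
      intro j hj
      have h1 := ih (j + 1) (by omega)
      rw [← hv.spineFunction_apply κ F (by omega : j + 1 + 1 ≤ k)] at h1
      have hp := hv.par (j + 1) (by omega)
      have h2 := hh.par_pos hw₀ h1 (by rw [hp]; exact hv.ne_root (by omega))
      rwa [hp, hhdef, hv.spineFunction_apply κ F (by omega : j + 1 ≤ k)] at h2
  have hpos : ∀ j < k, 0 < F (j + 1) := fun j hj => hFpos (k - (j + 1)) j (by omega)
  have hlt : ∀ j < k, F j < F (j + 1) := by
    intro j hj
    have h1 := hpos j hj
    rw [← hv.spineFunction_apply κ F (by omega : j + 1 ≤ k)] at h1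
    have h2 := hh.par_lt hw₀ h1
    rwa [hv.par j hj, hhdef, hv.spineFunction_apply κ F hj.le,
      hv.spineFunction_apply κ F (by omega : j + 1 ≤ k)] at h2
  have hgap : ∀ j < k, 0 < a j - b j := fun j hj => by
    have := hlt j hj
    rw [hF] at this
    linarith
  have hFstrict : ∀ i j, i < j → j ≤ k → F i < F j := fun i j hij hj =>
    (hlt i (by omega)).trans_le (hFmono hij)
  have hnr : ∀ j < k, w j ≠ T'.root := by
    intro j hj hr
    have h1 := haeq j hj
    have h2 := hpos j hj
    simp only [hadef, hr, hf.root] at h1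
    linarith
  have hb_eq : ∀ j < k, b j = F j := fun j hj => by
    have h1 := haeq j hj
    rw [hF] at h1
    linarith
  refine ⟨⟨rfl, fun u => ⟨fun hu => ?_, ?_⟩, fun j hj => ?_, fun i j hij hj => ?_⟩, fun hk => ?_⟩
  · obtain ⟨j, hj, rfl⟩ := hmem u hu
    exact ⟨j, hj, by simp⟩
  · rintro ⟨j, hj, rfl⟩
    simpa using mem_inner.2 ⟨hnr j hj, hdeg j hj⟩
  · have hbj := hb_eq j hj
    simp only [Nat.add_eq_zero_iff, one_ne_zero, and_false, if_false, Nat.add_sub_cancel]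
    by_cases hp : T'.par (w j) = T'.root
    · have : j = 0 := by
        by_contra hj0
        have h1 := hFstrict 0 j (by omega) hj.le
        simp only [hbdef, hp, hf.root] at hbj
        linarith
      rw [if_pos this, hp]
    · obtain ⟨i, hi, hwi⟩ := hmem _ (par_mem_inner (hnr j hj) hp)
      have h2 : b j = a i := by simp only [hbdef, hadef, hwi]
      rw [h2, haeq i hi] at hbj
      have hij : i + 1 = j := by
        rcases lt_trichotomy (i + 1) j with hlt' | heq' | hgt'
        · exact absurd hbj (hFstrict _ _ hlt' hj.le).ne
        · exact heq'
        · exact absurd hbj (hFstrict _ _ hgt' hi).ne'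
      rw [if_neg (by omega), ← hwi, ← hij, Nat.add_sub_cancel]
  · have := hsorted hlt i j hij hj
    have : (T'.degree (w i) : ℝ) ≤ T'.degree (w j) := by linarith
    simpa using (by exact_mod_cast this : T'.degree (w i) ≤ T'.degree (w j))
  · have h1 := hWeq 0 hk
    have h2 := hgap 0 hk
    exact (mul_right_cancel₀ (by positivity) h1).symm

end DirichletTree

/-! ### Existence of sorted caterpillars -/

theorem Finset.exists_sorted_enumeration {V : Type*} [Nonempty V] (s : Finset V) (key : V → ℕ) :
    ∃ w : ℕ → V, Set.InjOn w (Set.Iio s.card) ∧ (∀ u, u ∈ s ↔ ∃ j < s.card, w j = u) ∧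
      ∀ i j, i ≤ j → j < s.card → key (w i) ≤ key (w j) := by
  classical
  set e := s.equivFin.symm with he
  set σ := Tuple.sort fun j => key (e j) with hσ
  have hw : ∀ j (hj : j < s.card), (fun j => if h : j < s.card then (e (σ ⟨j, h⟩) : V) else
      Classical.arbitrary V) j = e (σ ⟨j, hj⟩) := fun j hj => dif_pos hj
  refine ⟨fun j => if h : j < s.card then e (σ ⟨j, h⟩) else Classical.arbitrary V,
    fun i hi j hj h => ?_, fun u => ⟨fun hu => ?_, ?_⟩, fun i j hij hj => ?_⟩
  · rw [hw i hi, hw j hj] at h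
    exact congrArg Fin.val (σ.injective (e.injective (Subtype.ext h)))
  · refine ⟨(σ.symm (e.symm ⟨u, hu⟩)).1, (σ.symm (e.symm ⟨u, hu⟩)).2, ?_⟩
    rw [hw _ (σ.symm (e.symm ⟨u, hu⟩)).2]
    simp
  · rintro ⟨j, hj, rfl⟩
    rw [hw j hj]
    exact (e _).2
  · rw [hw j hj, hw i (by omega)]
    exact Tuple.monotone_sort (fun j => key (e j))
      (show (⟨i, by omega⟩ : Fin s.card) ≤ ⟨j, hj⟩ from hij)

theorem Finset.exists_fiber_card_eq {V : Type*} [DecidableEq V] (p : ℕ → ℕ) (m : ℕ) :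
    ∀ P : Finset V, P.card = ∑ j ∈ Finset.range m, p j →
      ∃ φ : V → ℕ, (∀ q ∈ P, φ q < m) ∧ ∀ j < m, (P.filter fun q => φ q = j).card = p j := by
  induction m with
  | zero =>
    intro P hP
    have : P = ∅ := Finset.card_eq_zero.1 (by simpa using hP)
    exact ⟨fun _ => 0, by simp [this], by simp⟩
  | succ m ih =>
    intro P hP
    rw [Finset.sum_range_succ] at hP
    obtain ⟨Q, hQ, hQc⟩ := Finset.exists_subset_card_eq (s := P) (n := p m) (by omega)
    obtain ⟨φ, h1, h2⟩ := ih (P \ Q) (by rw [Finset.card_sdiff_of_subset hQ]; omega)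
    refine ⟨fun q => if q ∈ Q then m else φ q, fun q hq => ?_, fun j hj => ?_⟩
    · by_cases hqQ : q ∈ Q
      · simp [hqQ]
      · simpa [hqQ] using (h1 q (by simp [hq, hqQ])).trans (Nat.lt_succ_self m)
    · rcases Nat.lt_succ_iff_lt_or_eq.1 hj with hj | rfl
      · rw [← h2 j hj]
        congr 1
        ext q
        by_cases hqQ : q ∈ Q
        · simp [hqQ, hj.ne']
        · simp [hqQ]
      · rw [← hQc]
        congr 1
        ext q
        by_cases hqQ : q ∈ Q
        · simp [hqQ, hQ hqQ]
        · simp only [Finset.mem_filter, hqQ, if_false, iff_false, not_and]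
          intro hq h
          exact (h1 q (by simp [hq, hqQ])).ne h

/-- The graph in which every vertex other than `r` is joined to its image under `par`. -/
def SimpleGraph.ofParent {V : Type*} (r : V) (par : V → V) : SimpleGraph V :=
  SimpleGraph.fromRel fun u v => u ≠ r ∧ par u = v

theorem SimpleGraph.isTree_ofParent {V : Type*} [Finite V] (r : V) (par : V → V) (dep : V → ℕ)
    (h : ∀ u, u ≠ r → dep (par u) < dep u) : (SimpleGraph.ofParent r par).IsTree := by
  have hadj : ∀ u, u ≠ r → (SimpleGraph.ofParent r par).Adj u (par u) := fun u hu => by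
    refine (SimpleGraph.fromRel_adj _ _ _).2 ⟨fun heq => ?_, Or.inl ⟨hu, rfl⟩⟩
    have := h u hu
    rw [← heq] at this
    exact lt_irrefl _ this
  have hconn : (SimpleGraph.ofParent r par).Connected := by
    have : ∀ n u, dep u = n → (SimpleGraph.ofParent r par).Reachable u r := by
      intro n
      induction n using Nat.strong_induction_on with
      | _ n ih =>
        rintro u rfl
        by_cases hu : u = r
        · rw [hu]
        · exact (hadj u hu).reachable.trans (ih _ (h u hu) _ rfl)
    exact (SimpleGraph.connected_iff _).2
      ⟨fun u v => (this _ u rfl).trans (this _ v rfl).symm, ⟨r⟩⟩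
  refine SimpleGraph.isTree_iff_connected_and_card.2 ⟨hconn, ?_⟩
  refine le_antisymm ?_ hconn.card_vert_le_card_edgeSet_add_one
  classical
  have := Fintype.ofFinite V
  have hsurj : Function.Surjective fun u : {u : V // u ≠ r} =>
      (⟨s(u.1, par u), hadj u u.2⟩ : (SimpleGraph.ofParent r par).edgeSet) := by
    rintro ⟨e, he⟩
    induction e with
    | _ a b =>
      have hab : (SimpleGraph.fromRel fun u v => u ≠ r ∧ par u = v).Adj a b := he
      rcases ((SimpleGraph.fromRel_adj _ _ _).1 hab).2 with ⟨h1, h2⟩ | ⟨h1, h2⟩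
      · exact ⟨⟨a, h1⟩, by simp [h2]⟩
      · exact ⟨⟨b, h1⟩, by simp [h2, Sym2.eq_swap]⟩
  have h1 : Nat.card (SimpleGraph.ofParent r par).edgeSet ≤ Nat.card {u : V // u ≠ r} :=
    Nat.card_le_card_of_surjective _ hsurj
  have h2 : Nat.card {u : V // u ≠ r} = Nat.card V - 1 := by
    simp [Nat.card_eq_fintype_card, Fintype.card_subtype_compl]
  have h3 : 0 < Nat.card V := Nat.card_pos_iff.2 ⟨⟨r⟩, inferInstance⟩
  omega

namespace DirichletTree

variable {V : Type*} {T : DirichletTree V}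

/-- A map that sends every vertex to a neighbour and decreases some rank is the parent map. -/
theorem par_eq_of_rank {par : V → V} {dep : V → ℕ}
    (h : ∀ u, u ≠ T.root → dep (par u) < dep u ∧ T.graph.Adj (par u) u) :
    ∀ u, u ≠ T.root → T.par u = par u := by
  have : ∀ n u, dep u = n → u ≠ T.root → T.par u = par u := by
    intro n
    induction n using Nat.strong_induction_on with
    | _ n ih =>
      rintro u rfl hu
      obtain ⟨h1, h2⟩ := h u hu
      -- If `u` were the parent of `par u`, the rank would decrease from `par u` to `u`.
      rcases T.adj_iff_par.1 h2 with ⟨h3, h4⟩ | h3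
      · have h5 := ih _ h1 (par u) rfl h3
        have h6 := (h _ h3).1
        rw [← h5, h4] at h6
        omega
      · exact h3.2
  exact fun u => this _ u rfl

variable [Fintype V]

theorem sum_degree (T : DirichletTree V) :
    ∑ u, T.degree u + 2 = 2 * Fintype.card V := by
  classical
  simp_rw [degree_eq_card_children, Finset.sum_add_distrib]
  have h1 := T.sum_par fun _ _ => 1
  simp only [Finset.sum_const, smul_eq_mul, mul_one] at h1
  rw [h1]
  have h2 : (Finset.univ.filter fun c => c ≠ T.root).card = Fintype.card V - 1 := by
    rw [Finset.filter_ne', Finset.card_erase_of_mem (Finset.mem_univ _), Finset.card_univ]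
  have h3 : ∑ u, (if u = T.root then 0 else 1) = (Finset.univ.filter fun c => c ≠ T.root).card := by
    rw [Finset.card_filter]
    exact Finset.sum_congr rfl fun u _ => by split_ifs <;> simp_all
  have h4 : 0 < Fintype.card V := Fintype.card_pos_iff.2 ⟨T.root⟩
  rw [h3, h2]
  omega

/-- For every choice of the root there is a tree with a sorted spine in which every vertex keeps its
degree. Its distinguished edge ends at a pendant vertex unless the root itself is pendant. -/
theorem exists_isSortedSpine (T : DirichletTree V) (r : V) :
    ∃ C : DirichletTree V, C.root = r ∧ (∀ u, C.degree u = T.degree u) ∧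
      (∃ k v, C.IsSortedSpine k v) ∧ (C.degree C.root = 1 ∨ C.degree C.mark = 1) := by
  classical
  have : Nonempty V := ⟨r⟩
  set I : Finset V := {u | u ≠ r ∧ T.degree u ≠ 1} with hI
  set P : Finset V := {u | u ≠ r ∧ T.degree u = 1} with hP
  have memI : ∀ u, u ∈ I ↔ u ≠ r ∧ T.degree u ≠ 1 := fun u => by simp [hI]
  have memP : ∀ u, u ∈ P ↔ u ≠ r ∧ T.degree u = 1 := fun u => by simp [hP]
  obtain ⟨w, hwinj, hwmem, hwmono⟩ := I.exists_sorted_enumeration T.degree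
  set k := I.card with hk
  set v : ℕ → V := fun j => if j = 0 then r else w (j - 1) with hv
  have hv0 : v 0 = r := rfl
  have hvs : ∀ j, v (j + 1) = w j := fun j => by simp [hv]
  have hvI : ∀ j < k, v (j + 1) ∈ I := fun j hj => (hwmem _).2 ⟨j, hj, (hvs j).symm⟩
  have hvr : ∀ j < k, v (j + 1) ≠ r := fun j hj => ((memI _).1 (hvI j hj)).1
  have hvinj : ∀ i ≤ k, ∀ j ≤ k, v i = v j → i = j := by
    intro i hi j hj h
    cases i with
    | zero => cases j with
      | zero => rfl
      | succ j => exact absurd h.symm (hvr j hj)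
    | succ i => cases j with
      | zero => exact absurd h (hvr i hi)
      | succ j =>
        rw [hvs, hvs] at h
        rw [hwinj (show i < k from hi) (show j < k from hj) h]
  have hvP : ∀ j ≤ k, v j ∉ P := by
    intro j hj h
    rw [memP] at h
    cases j with
    | zero => exact h.1 hv0
    | succ j => exact ((memI _).1 (hvI j hj)).2 h.2
  have hex : ∀ u, u ∉ P → ∃ j ≤ k, v j = u := by
    intro u hu
    by_cases hur : u = r
    · exact ⟨0, Nat.zero_le _, by rw [hv0, hur]⟩
    · have : u ∈ I := (memI u).2 ⟨hur, fun h => hu ((memP u).2 ⟨hur, h⟩)⟩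
      obtain ⟨j, hj, rfl⟩ := (hwmem u).1 this
      exact ⟨j + 1, hj, hvs j⟩
  choose! pos hposk hpos using hex
  have hposv : ∀ j ≤ k, pos (v j) = j := fun j hj =>
    hvinj _ (hposk _ (hvP j hj)) _ hj (hpos _ (hvP j hj))
  -- The number of pendant vertices to be attached at the `j`-th vertex of the spine.
  set p : ℕ → ℕ := fun j => T.degree (v j) - (if j = 0 then 0 else 1) - (if j = k then 0 else 1)
    with hp
  have hpj : ∀ j ≤ k,
      T.degree (v j) = p j + (if j = 0 then 0 else 1) + (if j = k then 0 else 1) := by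
    intro j hj
    have h1 := T.degree_pos (v j)
    simp only [hp]
    cases j with
    | zero => simp only [if_true]; split_ifs <;> omega
    | succ j =>
      have h2 := ((memI _).1 (hvI j hj)).2
      split_ifs <;> omega
  have hPcard : P.card = ∑ j ∈ Finset.range (k + 1), p j := by
    have h1 := T.sum_degree
    have hdisj : Disjoint I P := Finset.disjoint_left.2 fun u h1 h2 =>
      ((memI u).1 h1).2 ((memP u).1 h2).2
    have hrIP : r ∉ I ∪ P := by simp [memI, memP]
    have huniv : (Finset.univ : Finset V) = insert r (I ∪ P) := by
      ext u
      simp only [Finset.mem_univ, Finset.mem_insert, Finset.mem_union, memI, memP, true_iff]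
      tauto
    have h2 : Fintype.card V = k + P.card + 1 := by
      rw [← Finset.card_univ, huniv, Finset.card_insert_of_notMem hrIP,
        Finset.card_union_of_disjoint hdisj]
    have hIim : I = (Finset.range k).image fun j => v (j + 1) := by
      ext u
      simp [hwmem, hvs]
    have h3 : ∑ u ∈ I, T.degree u = ∑ j ∈ Finset.range k, T.degree (v (j + 1)) := by
      conv_lhs => rw [hIim]
      rw [Finset.sum_image]
      intro i hi j hj h
      have := hvinj _ (Nat.succ_le_of_lt (Finset.mem_range.1 hi)) _
        (Nat.succ_le_of_lt (Finset.mem_range.1 hj)) h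
      omega
    have h4 : ∑ u ∈ P, T.degree u = P.card := by
      rw [Finset.card_eq_sum_ones]
      exact Finset.sum_congr rfl fun u hu => ((memP u).1 hu).2
    rw [huniv, Finset.sum_insert hrIP, Finset.sum_union hdisj, h3, h4] at h1
    have h7 := Finset.sum_range_succ' (fun j => T.degree (v j)) k
    rw [hv0] at h7
    have h8 : ∑ j ∈ Finset.range (k + 1), T.degree (v j) = ∑ j ∈ Finset.range (k + 1), p j +
        ∑ j ∈ Finset.range (k + 1), (if j = 0 then 0 else 1) +
        ∑ j ∈ Finset.range (k + 1), (if j = k then 0 else 1) := by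
      rw [← Finset.sum_add_distrib, ← Finset.sum_add_distrib]
      exact Finset.sum_congr rfl fun j hj => hpj j (Nat.lt_succ_iff.1 (Finset.mem_range.1 hj))
    have h5 : ∑ j ∈ Finset.range (k + 1), (if j = 0 then 0 else 1) = k := by
      rw [Finset.sum_range_succ']
      simp
    have h6 : ∑ j ∈ Finset.range (k + 1), (if j = k then 0 else 1) = k := by
      rw [Finset.sum_range_succ, if_pos rfl, add_zero,
        Finset.sum_congr rfl fun j hj => if_neg (Finset.mem_range.1 hj).ne]
      simp
    omega
  obtain ⟨φ, hφ, hφc⟩ := Finset.exists_fiber_card_eq p (k + 1) P hPcard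
  set par : V → V := fun u => if u ∈ P then v (φ u) else v (pos u - 1) with hpar
  set dep : V → ℕ := fun u => if u ∈ P then k + 1 else pos u with hdep
  have hparP : ∀ u ∈ P, par u = v (φ u) := fun u hu => if_pos hu
  have hparv : ∀ j < k, par (v (j + 1)) = v j := fun j hj => by
    simp only [hpar]
    rw [if_neg (hvP _ hj), hposv _ hj, Nat.succ_sub_one]
  have hdepv : ∀ j ≤ k, dep (v j) = j := fun j hj => by
    simp only [hdep]
    rw [if_neg (hvP _ hj), hposv _ hj]
  have hcases : ∀ u, u ≠ r → u ∈ P ∨ ∃ j < k, v (j + 1) = u := by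
    intro u hu
    by_cases huP : u ∈ P
    · exact Or.inl huP
    · obtain ⟨j, hj, h⟩ := (hwmem u).1 ((memI u).2 ⟨hu, fun h => huP ((memP u).2 ⟨hu, h⟩)⟩)
      exact Or.inr ⟨j, hj, (hvs j).trans h⟩
  have hdec : ∀ u, u ≠ r → dep (par u) < dep u := by
    intro u hu
    rcases hcases u hu with huP | ⟨j, hj, rfl⟩
    · rw [hparP u huP, hdepv _ (Nat.lt_succ_iff.1 (hφ u huP))]
      simp only [hdep]
      rw [if_pos huP]
      exact hφ u huP
    · rw [hparv j hj, hdepv _ hj, hdepv _ hj.le]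
      exact Nat.lt_succ_self j
  have hadj : ∀ u, u ≠ r → (SimpleGraph.ofParent r par).Adj (par u) u := fun u hu => by
    refine (SimpleGraph.fromRel_adj _ _ _).2 ⟨fun heq => ?_, Or.inr ⟨hu, rfl⟩⟩
    have := hdec u hu
    rw [heq] at this
    exact lt_irrefl _ this
  obtain ⟨m, hmr, hmp, hm1⟩ : ∃ m, m ≠ r ∧ par m = r ∧ (T.degree r = 1 ∨ T.degree m = 1) := by
    by_cases hp0 : p 0 = 0
    · have h1 := hpj 0 (Nat.zero_le k)
      have h2 := T.degree_pos (v 0)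
      rw [hp0, if_pos rfl] at h1
      have hk0 : 0 ≠ k := fun h => by
        rw [if_pos h] at h1
        omega
      rw [if_neg hk0] at h1
      exact ⟨v 1, hvr 0 (by omega), hparv 0 (by omega), Or.inl h1⟩
    · have h1 := hφc 0 (Nat.succ_pos k)
      obtain ⟨q, hq⟩ := Finset.card_pos.1 (by omega : 0 < (P.filter fun q => φ q = 0).card)
      rw [Finset.mem_filter] at hq
      exact ⟨q, ((memP q).1 hq.1).1, by rw [hparP q hq.1, hq.2, hv0], Or.inr ((memP q).1 hq.1).2⟩
  let C : DirichletTree V :=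
    { graph := SimpleGraph.ofParent r par
      isTree := SimpleGraph.isTree_ofParent r par dep hdec
      root := r
      mark := m
      adj_mark := hmp ▸ hadj m hmr }
  have hCr : C.root = r := rfl
  have hCpar : ∀ u, u ≠ r → C.par u = par u :=
    par_eq_of_rank (T := C) (dep := dep) fun u hu => ⟨hdec u hu, hadj u hu⟩
  have hchild : ∀ u c, c ∈ C.children u ↔ c ≠ r ∧ par c = u := fun u c => by
    rw [mem_children, hCr]
    constructor
    · rintro ⟨h1, h2⟩
      exact ⟨h1, by rwa [← hCpar c h1]⟩
    · rintro ⟨h1, h2⟩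
      exact ⟨h1, by rwa [hCpar c h1]⟩
  have hchildv : ∀ j ≤ k, (C.children (v j)).card = p j + if j = k then 0 else 1 := by
    intro j hj
    rw [← hφc j (Nat.lt_succ_of_le hj)]
    have hPv : ∀ c ∈ P, (par c = v j ↔ φ c = j) := fun c hc => by
      rw [hparP c hc]
      exact ⟨hvinj _ (Nat.lt_succ_iff.1 (hφ c hc)) _ hj, fun h => by rw [h]⟩
    by_cases hjk : j = k
    · rw [if_pos hjk, add_zero]
      congr 1
      ext c
      rw [hchild, Finset.mem_filter]
      constructor
      · rintro ⟨h1, h2⟩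
        rcases hcases c h1 with hc | ⟨i, hi, rfl⟩
        · exact ⟨hc, (hPv c hc).1 h2⟩
        · rw [hparv i hi] at h2
          have := hvinj _ hi.le _ hj h2
          omega
      · rintro ⟨h1, h2⟩
        exact ⟨((memP c).1 h1).1, (hPv c h1).2 h2⟩
    · have hjk' : j < k := by omega
      rw [if_neg hjk, ← Finset.card_insert_of_notMem (a := v (j + 1))
        (fun h => hvP (j + 1) hjk' (Finset.mem_filter.1 h).1)]
      congr 1
      ext c
      rw [hchild, Finset.mem_insert, Finset.mem_filter]
      constructor
      · rintro ⟨h1, h2⟩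
        rcases hcases c h1 with hc | ⟨i, hi, rfl⟩
        · exact Or.inr ⟨hc, (hPv c hc).1 h2⟩
        · rw [hparv i hi] at h2
          rw [hvinj _ hi.le _ hj h2]
          exact Or.inl rfl
      · rintro (rfl | ⟨h1, h2⟩)
        · exact ⟨hvr j hjk', hparv j hjk'⟩
        · exact ⟨((memP c).1 h1).1, (hPv c h1).2 h2⟩
  have hdeg : ∀ u, C.degree u = T.degree u := by
    intro u
    rw [C.degree_eq_card_children u, hCr]
    by_cases huP : u ∈ P
    · have : C.children u = ∅ := by
        rw [Finset.eq_empty_iff_forall_notMem]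
        intro c hc
        obtain ⟨h1, h2⟩ := (hchild u c).1 hc
        rcases hcases c h1 with hc | ⟨i, hi, rfl⟩
        · rw [hparP c hc] at h2
          exact hvP _ (Nat.lt_succ_iff.1 (hφ c hc)) (h2 ▸ huP)
        · rw [hparv i hi] at h2
          exact hvP _ hi.le (h2 ▸ huP)
      rw [this, if_neg ((memP u).1 huP).1, ((memP u).1 huP).2, Finset.card_empty]
    · obtain ⟨hj, hju⟩ := And.intro (hposk u huP) (hpos u huP)
      generalize pos u = j at hj hju
      subst hju
      rw [hchildv j hj, hpj j hj]
      cases j with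
      | zero => simp [hv0]
      | succ j =>
        rw [if_neg (hvr j hj), if_neg (Nat.succ_ne_zero j)]
        omega
  refine ⟨C, rfl, hdeg, ⟨k, v, hv0, fun u => ?_, fun j hj => ?_, fun i j hij hj => ?_⟩, ?_⟩
  · rw [mem_inner, hdeg, hCr, ← memI, hwmem]
    simp only [hvs]
  · rw [hCpar _ (hvr j hj), hparv j hj]
  · rw [hdeg, hdeg, hvs, hvs]
    exact hwmono i j hij hj
  · rw [hdeg, hdeg]
    exact hm1

end DirichletTree

/-! ### Spines as walks -/

namespace DirichletTree

theorem exists_walk_support_eq {V : Type*} {G : SimpleGraph V} {v : ℕ → V} (k : ℕ)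
    (h : ∀ j < k, G.Adj (v j) (v (j + 1))) :
    ∃ p : G.Walk (v 0) (v k), p.support = (List.range (k + 1)).map v := by
  induction k with
  | zero => exact ⟨SimpleGraph.Walk.nil, by simp⟩
  | succ k ih =>
    obtain ⟨p, hp⟩ := ih fun j hj => h j (by omega)
    refine ⟨p.concat (h k (by omega)), ?_⟩
    rw [SimpleGraph.Walk.support_concat, hp, List.range_succ (n := k + 1)]
    simp

variable {V : Type*} [Fintype V] {T : DirichletTree V} {k : ℕ} {v : ℕ → V}

theorem IsSortedSpine.adj_iff (hv : T.IsSortedSpine k v) {i j : ℕ} (hi : i ≤ k) (hj : j ≤ k) :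
    T.graph.Adj (v i) (v j) ↔ i + 1 = j ∨ j + 1 = i := by
  have key : ∀ i ≤ k, ∀ j ≤ k, (v i ≠ T.root ∧ T.par (v i) = v j ↔ j + 1 = i) := by
    intro i hi j hj
    cases i with
    | zero => simp [hv.zero]
    | succ i =>
      rw [hv.par i hi]
      constructor
      · rintro ⟨-, h⟩
        rw [hv.injOn (Set.mem_Iic.2 (by omega)) (Set.mem_Iic.2 hj) h]
      · intro h
        rw [Nat.succ_injective h]
        exact ⟨hv.ne_root hi, rfl⟩
  rw [adj_iff_par, key i hi j hj, key j hj i hi, or_comm]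

theorem IsSortedSpine.isCaterpillar (hv : T.IsSortedSpine k v) : T.IsCaterpillar := by
  classical
  -- The pendant root has to be dropped from the spine, hence the shift `s`.
  obtain ⟨s, m, hsm, hs⟩ : ∃ s m, m + s = k + 1 ∧ ∀ u, T.degree u ≠ 1 ↔ ∃ j < m, v (j + s) = u := by
    have hin : ∀ u, u ≠ T.root → (T.degree u ≠ 1 ↔ ∃ j < k, v (j + 1) = u) := fun u hu => by
      rw [← hv.mem_iff, mem_inner]
      tauto
    by_cases hr : T.degree T.root = 1
    · refine ⟨1, k, rfl, fun u => ?_⟩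
      by_cases hu : u = T.root
      · subst hu
        simp only [hr, ne_eq, not_true_eq_false, false_iff]
        rintro ⟨j, hj, h⟩
        exact hv.ne_root hj h
      · exact hin u hu
    · refine ⟨0, k + 1, rfl, fun u => ?_⟩
      by_cases hu : u = T.root
      · subst hu
        exact iff_of_true hr ⟨0, Nat.succ_pos k, hv.zero⟩
      · rw [hin u hu]
        constructor
        · rintro ⟨j, hj, rfl⟩
          exact ⟨j + 1, by omega, rfl⟩
        · rintro ⟨j, hj, rfl⟩
          cases j with
          | zero => exact absurd hv.zero hu
          | succ j => exact ⟨j, by omega, rfl⟩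
  have hbij : Function.Bijective fun j : Fin m =>
      (⟨v (j + s), (hs _).2 ⟨j, j.2, rfl⟩⟩ : {u | T.degree u ≠ 1}) := by
    constructor
    · intro i j h
      have h1 := hv.injOn (Set.mem_Iic.2 (by omega)) (Set.mem_Iic.2 (by omega))
        (Subtype.ext_iff.1 h)
      exact Fin.ext (by omega)
    · rintro ⟨u, hu⟩
      obtain ⟨j, hj, rfl⟩ := (hs u).1 hu
      exact ⟨⟨j, hj⟩, rfl⟩
  let e : SimpleGraph.pathGraph m ≃g T.graph.induce {u | T.degree u ≠ 1} :=
    { toEquiv := Equiv.ofBijective _ hbij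
      map_rel_iff' := by
        intro i j
        rw [SimpleGraph.pathGraph_adj]
        change T.graph.Adj (v (i + s)) (v (j + s)) ↔ _
        rw [hv.adj_iff (by omega) (by omega)]
        omega }
  exact ⟨m, ⟨e.symm⟩⟩

theorem IsSortedSpine.exists_isSpine (hv : T.IsSortedSpine k v) :
    ∃ (u : V) (p : T.graph.Walk T.root u), T.IsSpine p ∧
      (p.support.tail.map T.degree).Pairwise (· ≤ ·) := by
  obtain ⟨p, hp⟩ := exists_walk_support_eq (G := T.graph) k fun j hj =>
    (hv.adj_iff hj.le hj).2 (Or.inl rfl)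
  refine ⟨v k, p.copy hv.zero rfl, ⟨?_, fun u => ?_⟩, ?_⟩
  · rw [SimpleGraph.Walk.isPath_def, SimpleGraph.Walk.support_copy, hp]
    refine List.Nodup.map_on (fun i hi j hj h => ?_) List.nodup_range
    exact hv.injOn (Set.mem_Iic.2 (Nat.lt_succ_iff.1 (List.mem_range.1 hi)))
      (Set.mem_Iic.2 (Nat.lt_succ_iff.1 (List.mem_range.1 hj))) h
  · rw [SimpleGraph.Walk.support_copy, hp, List.mem_map]
    by_cases hu : u = T.root
    · exact iff_of_true ⟨0, by simp, hu ▸ hv.zero⟩ (Or.inl hu)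
    · have h1 : T.degree u ≠ 1 ↔ u ∈ T.inner := by rw [mem_inner]; tauto
      rw [or_iff_right hu, h1, hv.mem_iff]
      constructor
      · rintro ⟨j, hj, rfl⟩
        cases j with
        | zero => exact absurd hv.zero hu
        | succ j => exact ⟨j, by simpa using hj, rfl⟩
      · rintro ⟨j, hj, rfl⟩
        exact ⟨j + 1, by simpa using hj, rfl⟩
  · rw [SimpleGraph.Walk.support_copy, hp, List.range_succ_eq_map, List.map_cons, List.tail_cons,
      List.map_map, List.map_map, List.pairwise_map]
    exact List.pairwise_lt_range.imp_of_mem fun {i j} _ hj hij =>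
      hv.mono i j hij.le (List.mem_range.1 hj)

theorem exists_isSortedSpine_of_isSpine {u : V} {p : T.graph.Walk T.root u} (hp : T.IsSpine p)
    (hs : (p.support.tail.map T.degree).Pairwise (· ≤ ·)) : ∃ k v, T.IsSortedSpine k v := by
  have hinj : ∀ i ≤ p.length, ∀ j ≤ p.length, p.getVert i = p.getVert j → i = j :=
    fun i hi j hj h => hp.1.getVert_injOn hi hj h
  have hne : ∀ j < p.length, p.getVert (j + 1) ≠ T.root := by
    intro j hj h
    have := hinj (j + 1) hj 0 (Nat.zero_le _) (by rw [h, p.getVert_zero])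
    omega
  have hpar : ∀ j < p.length, T.par (p.getVert (j + 1)) = p.getVert j := by
    intro j
    induction j with
    | zero =>
      intro hj
      rcases T.adj_iff_par.1 (p.adj_getVert_succ hj) with h | h
      · exact absurd p.getVert_zero h.1
      · exact h.2
    | succ j ih =>
      intro hj
      rcases T.adj_iff_par.1 (p.adj_getVert_succ hj) with h | h
      · have h1 := ih (by omega)
        rw [h.2] at h1
        have := hinj _ hj _ (by omega) h1
        omega
      · exact h.2
  refine ⟨p.length, p.getVert, p.getVert_zero, fun x => ?_, hpar, fun i j hij hj => ?_⟩
  · have h1 : x ∈ T.inner ↔ x ≠ T.root ∧ x ∈ p.support := by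
      rw [mem_inner, hp.2]
      tauto
    rw [h1, SimpleGraph.Walk.mem_support_iff_exists_getVert]
    constructor
    · rintro ⟨h2, j, rfl, hj⟩
      cases j with
      | zero => exact absurd p.getVert_zero h2
      | succ j => exact ⟨j, hj, rfl⟩
    · rintro ⟨j, hj, rfl⟩
      exact ⟨hne j hj, j + 1, rfl, hj⟩
  · rcases hij.eq_or_lt with rfl | hij
    · exact le_rfl
    · have hlen := p.length_support
      have h2 := List.pairwise_iff_getElem.1 hs i j (by simp; omega) (by simp; omega) hij
      simpa [SimpleGraph.Walk.support_getElem_eq_getVert] using h2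

variable (T) in
theorem isCaterpillar_and_exists_isSpine_iff :
    (T.IsCaterpillar ∧ ∃ (u : V) (p : T.graph.Walk T.root u), T.IsSpine p ∧
      (p.support.tail.map T.degree).Pairwise (· ≤ ·)) ↔ ∃ k v, T.IsSortedSpine k v := by
  constructor
  · rintro ⟨-, u, p, hp, hs⟩
    exact exists_isSortedSpine_of_isSpine hp hs
  · rintro ⟨k, v, hv⟩
    exact ⟨hv.isCaterpillar, hv.exists_isSpine⟩

/-- If the root is pendant, its degree may be put in front of the sorted degrees. -/
theorem pairwise_support_iff (hr : T.degree T.root = 1) {u : V} (p : T.graph.Walk T.root u) :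
    (p.support.map T.degree).Pairwise (· ≤ ·) ↔
      (p.support.tail.map T.degree).Pairwise (· ≤ ·) := by
  conv_lhs => rw [← p.cons_tail_support]
  rw [List.map_cons, List.pairwise_cons, hr]
  refine and_iff_right fun x hx => ?_
  obtain ⟨y, -, rfl⟩ := List.mem_map.1 hx
  exact T.degree_pos y

end DirichletTree

/-! ### Minimality and the degree sequence -/

theorem Finset.map_val_eq_of_enumeration {V α : Type*} {s : Finset V} {k : ℕ} {w : ℕ → V}
    (hinj : Set.InjOn w (Set.Iio k)) (hmem : ∀ u, u ∈ s ↔ ∃ j < k, w j = u) (g : V → α) :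
    s.val.map g = (Finset.univ : Finset (Fin k)).val.map fun j : Fin k => g (w j) := by
  have : s = (Finset.univ : Finset (Fin k)).map
      ⟨fun j : Fin k => w j, fun i j h => Fin.ext (hinj i.2 j.2 h)⟩ := by
    ext u
    rw [hmem]
    simp only [Finset.mem_map, Finset.mem_univ, true_and, Fin.exists_iff]
    exact ⟨fun ⟨j, hj, h⟩ => ⟨j, hj, h⟩, fun ⟨j, hj, h⟩ => ⟨j, hj, h⟩⟩
  rw [this, Finset.map_val, Multiset.map_map]
  rfl

theorem exists_perm_of_map_univ_eq {ι α : Type*} [Fintype ι] {f g : ι → α}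
    (h : (Finset.univ : Finset ι).val.map f = (Finset.univ : Finset ι).val.map g) :
    ∃ σ : Equiv.Perm ι, ∀ j, f j = g (σ j) := by
  classical
  have hc : ∀ c, Nonempty ({a // f a = c} ≃ {b // g b = c}) := fun c => by
    refine ⟨Fintype.equivOfCardEq ?_⟩
    have := congrArg (Multiset.count c) h
    rw [Multiset.count_map, Multiset.count_map] at this
    rw [Fintype.card_subtype, Fintype.card_subtype]
    simpa [Finset.card, eq_comm] using this
  exact ⟨Equiv.ofFiberEquiv fun c => (hc c).some, fun j => (Equiv.ofFiberEquiv_map _ j).symm⟩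

namespace DirichletTree

variable {V : Type*} [Fintype V] {w₀ : ℝ} {T T' : DirichletTree V}

theorem IsSortedSpine.card_inner {k : ℕ} {v : ℕ → V} (hv : T.IsSortedSpine k v) :
    T.inner.card = k := by
  classical
  have : (T.inner.card : ℝ) = k := by simpa using hv.sum_inner fun _ => 1
  exact_mod_cast this

theorem isSortedSpine_of_inner_eq_empty (h : T.inner = ∅) :
    T.IsSortedSpine 0 fun _ => T.root :=
  ⟨rfl, by simp [h], by simp, by simp⟩

theorem eq_mark_of_par_eq_root (hr : T.degree T.root = 1) {u : V} (hu : u ≠ T.root)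
    (hp : T.par u = T.root) : u = T.mark := by
  rw [degree_eq_card_children, if_pos rfl, add_zero] at hr
  exact Finset.card_le_one.1 hr.le _ (T.mem_children.2 ⟨hu, hp⟩) _
    (T.mem_children.2 ⟨T.mark_ne_root, T.par_mark⟩)

/-- The comparison for a set `s` of vertices of `T'` with the same degrees as the inner vertices
of `T`; it consists of the inner vertices of `T'` and possibly of its root. The set is listed by
depth. By `hroot`, a heavy first edge on the spine of `T` is harmless: either the list starts with
the child of a pendant root, whose edge is heavy as well, or with the root of `T'` itself. -/
theorem IsSortedSpine.compare {k : ℕ} {v : ℕ → V} (hw₀ : 1 ≤ w₀) (hv : T.IsSortedSpine k v)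
    (hν : T'.firstDirichletEigenvalue w₀ < 1) (s : Finset V) (hs : T'.inner ⊆ s)
    (hdeg : s.val.map T'.degree = T.inner.val.map T.degree)
    (hroot : 0 < k → T.wt w₀ (v 1) = 1 ∨ T'.degree T'.root = 1 ∨ T'.root ∈ s) :
    T.firstDirichletEigenvalue w₀ ≤ T'.firstDirichletEigenvalue w₀ ∧
      (T.firstDirichletEigenvalue w₀ = T'.firstDirichletEigenvalue w₀ →
        ∃ v', T'.IsSortedSpine k v' ∧ (0 < k → T'.wt w₀ (v' 1) = T.wt w₀ (v 1))) := by
  classical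
  have : Nonempty V := ⟨T.root⟩
  have hcard : s.card = k := by
    rw [← hv.card_inner]
    simpa using congrArg Multiset.card hdeg
  obtain ⟨w, hinj, hmem, hmono⟩ := s.exists_sorted_enumeration T'.depth
  rw [hcard] at hinj hmem hmono
  rw [Finset.map_val_eq_of_enumeration hinj hmem,
    Finset.map_val_eq_of_enumeration (w := fun j => v (j + 1)) (k := k)
      (fun i hi j hj h => by
        have := hv.injOn (Set.mem_Iic.2 (Nat.succ_le_of_lt hi))
          (Set.mem_Iic.2 (Nat.succ_le_of_lt hj)) h
        omega) hv.mem_iff] at hdeg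
  obtain ⟨σ, hσ⟩ := exists_perm_of_map_univ_eq hdeg
  have hpar : ∀ i < k, ∀ j < k, w j ≠ T'.root → T'.par (w j) = w i → i < j := by
    intro i hi j hj hr hp
    by_contra! hij
    have h1 := hmono j i hij hi
    have h2 := T'.depth_par hr
    rw [hp] at h2
    omega
  have hwt : 0 < k → w 0 ≠ T'.root → T.wt w₀ (v 1) ≤ T'.wt w₀ (w 0) := by
    intro hk h0
    rcases hroot hk with h | h | h
    · rw [h]
      exact T'.one_le_wt hw₀ h0
    · have hp : T'.par (w 0) = T'.root := by
        by_contra hp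
        obtain ⟨i, hi, hwi⟩ := (hmem _).1 (hs (par_mem_inner h0 hp))
        have := hpar i hi 0 hk h0 hwi.symm
        omega
      rw [eq_mark_of_par_eq_root h h0 hp, wt_mark]
      exact T.wt_le hw₀ _
    · obtain ⟨i, hi, hwi⟩ := (hmem _).1 h
      have h1 := hmono 0 i (Nat.zero_le i) hi
      have h2 := T'.depth_par h0
      have h3 : T'.depth T'.root = 0 := SimpleGraph.dist_self
      rw [hwi, h3] at h1
      omega
  have key := hv.firstDirichletEigenvalue_le hw₀ hν hinj (fun u hu => (hmem u).1 (hs hu)) hpar σ hσ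
    hwt
  refine ⟨key.1, fun heq => ⟨_, (key.2 heq).1, fun hk => ?_⟩⟩
  simpa using (key.2 heq).2 hk

theorem filter_degreeSequence (T : DirichletTree V) : T.degreeSequence.filter (· ≠ 1) =
    (Finset.univ.filter fun u => T.degree u ≠ 1).val.map T.degree := by
  rw [degreeSequence, Multiset.filter_map]
  rfl

theorem inner_eq_of_degree_root_eq_one (hr : T.degree T.root = 1) :
    T.inner = Finset.univ.filter fun u => T.degree u ≠ 1 := by
  ext u
  simp only [mem_inner, Finset.mem_filter, Finset.mem_univ, true_and, and_iff_right_iff_imp]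
  rintro h rfl
  exact h hr

theorem filter_degree_eq_insert (hr : T.degree T.root ≠ 1) : letI := Classical.decEq V
    (Finset.univ.filter fun u => T.degree u ≠ 1) = insert T.root T.inner := by
  classical
  ext u
  simp only [mem_inner, Finset.mem_filter, Finset.mem_univ, true_and, Finset.mem_insert]
  constructor
  · tauto
  · rintro (rfl | h)
    · exact hr
    · exact h.2

theorem root_notMem_inner : T.root ∉ T.inner := fun h => (mem_inner.1 h).1 rfl

theorem map_degree_inner_eq (h : T'.degreeSequence = T.degreeSequence)
    (hr : T'.degree T'.root = T.degree T.root) :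
    T'.inner.val.map T'.degree = T.inner.val.map T.degree := by
  classical
  have h1 := congrArg (Multiset.filter (· ≠ 1)) h
  rw [filter_degreeSequence, filter_degreeSequence] at h1
  by_cases hd : T.degree T.root = 1
  · rwa [inner_eq_of_degree_root_eq_one hd, inner_eq_of_degree_root_eq_one (hr.trans hd)]
  · rw [filter_degree_eq_insert hd, filter_degree_eq_insert (hr ▸ hd),
      Finset.insert_val_of_notMem root_notMem_inner, Finset.insert_val_of_notMem root_notMem_inner,
      Multiset.map_cons, Multiset.map_cons, hr] at h1
    exact (Multiset.cons_inj_right _).1 h1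

variable (w₀) in
/-- The shape of the trees that minimize the first eigenvalue for a given degree of the root: a
sorted spine and a distinguished edge that ends at a pendant vertex, unless it has weight `1` or is
the only edge at the root. -/
def IsSortedCaterpillar (T : DirichletTree V) : Prop :=
  (∃ k v, T.IsSortedSpine k v) ∧ (w₀ = 1 ∨ T.degree T.root = 1 ∨ T.degree T.mark = 1)

/-- The stars centred at their root, which have no inner vertices, share their eigenvalue. -/
theorem firstDirichletEigenvalue_le_of_inner_eq_empty (hw₀ : 1 ≤ w₀) (hT : T.inner = ∅)
    (hT' : T'.inner = ∅) (hr : T'.degree T'.root = T.degree T.root) :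
    T.firstDirichletEigenvalue w₀ ≤ T'.firstDirichletEigenvalue w₀ := by
  have hpend : ∀ u, u ≠ T.root → T.degree u = 1 := fun u hu => by
    by_contra hd
    have : u ∈ T.inner := mem_inner.2 ⟨hu, hd⟩
    simp [hT] at this
  obtain ⟨q, hq, hνq⟩ := exists_wt_eq_firstDirichletEigenvalue hw₀ hT'
  rw [hνq]
  by_cases hex : ∃ u, u ≠ T.root ∧ u ≠ T.mark
  · obtain ⟨u, hu, hum⟩ := hex
    have h1 := firstDirichletEigenvalue_le_wt (w₀ := w₀) hu (hpend u hu)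
    rw [T.wt_of_ne w₀ hu hum] at h1
    exact h1.trans (T'.one_le_wt hw₀ hq)
  · push Not at hex
    have hd : T.degree T.root = 1 := by
      have : T.children T.root = {T.mark} := by
        ext c
        rw [mem_children, Finset.mem_singleton]
        constructor
        · exact fun h => hex c h.1
        · rintro rfl
          exact ⟨T.mark_ne_root, T.par_mark⟩
      rw [degree_eq_card_children, if_pos rfl, this, Finset.card_singleton]
    have hp : T'.par q = T'.root := by
      by_contra hp
      have := par_mem_inner hq hp
      simp [hT'] at this
    rw [eq_mark_of_par_eq_root (hr.trans hd) hq hp, wt_mark]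
    exact (firstDirichletEigenvalue_le_wt T.mark_ne_root
      (hpend _ T.mark_ne_root)).trans_eq (T.wt_mark w₀)

theorem IsSortedCaterpillar.firstDirichletEigenvalue_le (hw₀ : 1 ≤ w₀)
    (hT : T.IsSortedCaterpillar w₀) (h : T'.degreeSequence = T.degreeSequence)
    (hr : T'.degree T'.root = T.degree T.root) :
    T.firstDirichletEigenvalue w₀ ≤ T'.firstDirichletEigenvalue w₀ ∧
      (T.firstDirichletEigenvalue w₀ = T'.firstDirichletEigenvalue w₀ →
        T'.IsSortedCaterpillar w₀) := by
  have hmap := map_degree_inner_eq h hr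
  have hcard : T'.inner.card = T.inner.card := by simpa using congrArg Multiset.card hmap
  by_cases hT' : T'.inner = ∅
  · have hT0 : T.inner = ∅ := Finset.card_eq_zero.1 (by rw [← hcard, hT', Finset.card_empty])
    refine ⟨firstDirichletEigenvalue_le_of_inner_eq_empty hw₀ hT0 hT' hr, fun _ =>
      ⟨⟨_, _, isSortedSpine_of_inner_eq_empty hT'⟩, Or.inr (Or.inr ?_)⟩⟩
    by_contra hd
    have : T'.mark ∈ T'.inner := mem_inner.2 ⟨T'.mark_ne_root, hd⟩
    simp [hT'] at this
  obtain ⟨⟨k, v, hv⟩, hmark⟩ := hT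
  have hwt1 : 0 < k → ¬ T.degree T.root = 1 → T.wt w₀ (v 1) = 1 := by
    intro hk hd
    rcases hmark with hw | hw | hw
    · exact le_antisymm ((T.wt_le hw₀ _).trans hw.le) (T.one_le_wt hw₀ (hv.ne_root hk))
    · exact absurd hw hd
    · refine T.wt_of_ne w₀ (hv.ne_root hk) fun heq => hv.degree_ne_one hk ?_
      rw [zero_add, heq, hw]
  have hν := firstDirichletEigenvalue_lt_one (w₀ := w₀) (Finset.nonempty_iff_ne_empty.2 hT')
  have key := hv.compare hw₀ hν T'.inner subset_rfl hmap fun hk => by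
    by_cases hd : T.degree T.root = 1
    · exact Or.inr (Or.inl (hr.trans hd))
    · exact Or.inl (hwt1 hk hd)
  refine ⟨key.1, fun heq => ?_⟩
  obtain ⟨v', hv', hwt'⟩ := key.2 heq
  refine ⟨⟨k, v', hv'⟩, ?_⟩
  by_cases hd : T.degree T.root = 1
  · exact Or.inr (Or.inl (hr.trans hd))
  by_cases hm : T'.degree T'.mark = 1
  · exact Or.inr (Or.inr hm)
  -- An inner endpoint of the distinguished edge is the first vertex of the spine, of weight `1`.
  obtain ⟨j, hj, hjm⟩ := (hv'.mem_iff _).1 (mem_inner.2 ⟨T'.mark_ne_root, hm⟩)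
  have h1 := hv'.par j hj
  rw [hjm, par_mark, ← hv'.zero] at h1
  have h2 := hv'.injOn (Set.mem_Iic.2 (Nat.zero_le k)) (Set.mem_Iic.2 hj.le) h1
  subst h2
  have h3 := hwt' hj
  rw [hwt1 hj hd, ← zero_add 1, hjm, wt_mark] at h3
  exact Or.inl h3

/-- A sorted caterpillar with a pendant root also beats all trees with a non-pendant root. -/
theorem IsSortedCaterpillar.firstDirichletEigenvalue_le_of_degree_root (hw₀ : 1 ≤ w₀)
    (hT : T.IsSortedCaterpillar w₀) (hr : T.degree T.root = 1)
    (h : T'.degreeSequence = T.degreeSequence) :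
    T.firstDirichletEigenvalue w₀ ≤ T'.firstDirichletEigenvalue w₀ ∧
      (T.firstDirichletEigenvalue w₀ = T'.firstDirichletEigenvalue w₀ →
        T'.degree T'.root = 1 ∧ T'.IsSortedCaterpillar w₀) := by
  classical
  by_cases hr' : T'.degree T'.root = 1
  · have := hT.firstDirichletEigenvalue_le hw₀ h (hr'.trans hr.symm)
    exact ⟨this.1, fun heq => ⟨hr', this.2 heq⟩⟩
  obtain ⟨⟨k, v, hv⟩, -⟩ := hT
  have hmap := congrArg (Multiset.filter (· ≠ 1)) h
  rw [filter_degreeSequence, filter_degreeSequence, ← inner_eq_of_degree_root_eq_one hr] at hmap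
  have hins := filter_degree_eq_insert hr'
  have hcard : T'.inner.card + 1 = k := by
    have := congrArg Multiset.card hmap
    rw [Multiset.card_map, Multiset.card_map, Finset.card_val, Finset.card_val, hv.card_inner,
      hins, Finset.card_insert_of_notMem root_notMem_inner] at this
    exact this
  have hlt : T.firstDirichletEigenvalue w₀ < 1 := firstDirichletEigenvalue_lt_one
    (Finset.card_pos.1 (by rw [hv.card_inner]; omega))
  by_cases hν : T'.firstDirichletEigenvalue w₀ < 1
  · have key := hv.compare hw₀ hν _ (by rw [hins]; exact Finset.subset_insert _ _) hmap
      fun _ => Or.inr (Or.inr (by rw [hins]; exact Finset.mem_insert_self _ _))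
    refine ⟨key.1, fun heq => ?_⟩
    -- In the case of equality the root of `T'` would be an inner vertex.
    obtain ⟨v', hv', -⟩ := key.2 heq
    have := hv'.card_inner
    omega
  · exact ⟨by linarith, fun heq => by linarith⟩

theorem degreeSequence_congr (h : ∀ u, T'.degree u = T.degree u) :
    T'.degreeSequence = T.degreeSequence :=
  Multiset.map_congr rfl fun u _ => h u

theorem exists_isSortedCaterpillar (w₀ : ℝ) (T : DirichletTree V) (r : V) : ∃ C : DirichletTree V,
    C.IsSortedCaterpillar w₀ ∧ C.degreeSequence = T.degreeSequence ∧
      C.degree C.root = T.degree r := by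
  obtain ⟨C, rfl, hdeg, hspine, hmark⟩ := T.exists_isSortedSpine r
  exact ⟨C, ⟨hspine, Or.inr hmark⟩, degreeSequence_congr hdeg, hdeg _⟩

theorem exists_degree_eq_one (T : DirichletTree V) : ∃ u, T.degree u = 1 := by
  by_cases h : T.inner.Nonempty
  · obtain ⟨q, -, hq, -⟩ := exists_pendant_of_inner_nonempty h
    exact ⟨q, hq⟩
  · refine ⟨T.mark, ?_⟩
    by_contra hd
    exact h ⟨_, mem_inner.2 ⟨T.mark_ne_root, hd⟩⟩

end DirichletTree

/-- A fixed weight `w₀ ≥ 1` and a degree sequence `π` are given; `T` is a rooted tree with degree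
sequence `π`. The first part characterizes minimality among all rooted trees with degree sequence
`π`, the second part minimality among those whose root has moreover the same degree as that
of `T`. -/
theorem mainTheorem2 {V : Type*} [Fintype V] (w₀ : ℝ) (hw₀ : 1 ≤ w₀) (π : Multiset ℕ)
    (T : DirichletTree V) (hT : T.degreeSequence = π) :
    ((∀ T' : DirichletTree V, T'.degreeSequence = π →
        T.firstDirichletEigenvalue w₀ ≤ T'.firstDirichletEigenvalue w₀) ↔
      T.IsCaterpillar ∧ T.degree T.root = 1 ∧
        ∃ (v : V) (p : T.graph.Walk T.root v), T.IsSpine p ∧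
          (p.support.map T.degree).Pairwise (· ≤ ·)) ∧
    ((∀ T' : DirichletTree V, T'.degreeSequence = π → T'.degree T'.root = T.degree T.root →
        T.firstDirichletEigenvalue w₀ ≤ T'.firstDirichletEigenvalue w₀) ↔
      T.IsCaterpillar ∧
        (∃ (v : V) (p : T.graph.Walk T.root v), T.IsSpine p ∧
          (p.support.tail.map T.degree).Pairwise (· ≤ ·)) ∧
        (w₀ = 1 ∨ T.degree T.root = 1 ∨ T.degree T.mark = 1)) := by
  subst hT
  constructor
  · have hshape : (T.IsCaterpillar ∧ T.degree T.root = 1 ∧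
        ∃ (v : V) (p : T.graph.Walk T.root v), T.IsSpine p ∧
          (p.support.map T.degree).Pairwise (· ≤ ·)) ↔
        T.degree T.root = 1 ∧ T.IsSortedCaterpillar w₀ := by
      rw [and_left_comm]
      refine and_congr_right fun hr => ?_
      simp only [T.pairwise_support_iff hr]
      rw [T.isCaterpillar_and_exists_isSpine_iff, DirichletTree.IsSortedCaterpillar]
      exact (and_iff_left (Or.inr (Or.inl hr))).symm
    rw [hshape]
    constructor
    · intro hmin
      obtain ⟨r, hr⟩ := T.exists_degree_eq_one
      obtain ⟨C, hC, hseq, hroot⟩ := DirichletTree.exists_isSortedCaterpillar w₀ T r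
      have key := hC.firstDirichletEigenvalue_le_of_degree_root hw₀ (hroot.trans hr) hseq.symm
      exact key.2 (key.1.antisymm (hmin C hseq))
    · rintro ⟨hr, hmin⟩ T' hT'
      exact (hmin.firstDirichletEigenvalue_le_of_degree_root hw₀ hr hT').1
  · rw [← and_assoc, T.isCaterpillar_and_exists_isSpine_iff]
    change _ ↔ T.IsSortedCaterpillar w₀
    constructor
    · intro hmin
      obtain ⟨C, hC, hseq, hroot⟩ := DirichletTree.exists_isSortedCaterpillar w₀ T T.root
      have key := hC.firstDirichletEigenvalue_le hw₀ hseq.symm hroot.symm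
      exact key.2 (key.1.antisymm (hmin C hseq hroot))
    · intro hmin T' hT' hr
      exact (hmin.firstDirichletEigenvalue_le hw₀ hT' hr).1
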